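/- Let $D\subset\mathbb R^3$ be a bounded connected open set with smooth boundary and unit outer normal $\nu$, let $T_0>0$, and let $B=B(p,r)$, $r>0$, be an open ball with $B\subset\mathbb R^3\setminus\overline D$. For $f,g\in L^2((0,T_0)\times\partial D)$, a solution of the wave problem with data $(f,g)$ is a function $u\in L^\infty(0,T_0;H^1(\mathbb R^3\setminus\overline D))$ with $\partial_t u\in L^\infty(0,T_0;L^2(\mathbb R^3\setminus\overline D))$ that satisfies, in the weak sense, $$\partial_t^2u-\Delta u=0\ \text{ in }(0,T_0)\times(\mathbb R^3\setminus\overline D),\qquad u|_{t=0}=0,\quad \partial_tu|_{t=0}=0,$$ $$u|_{(0,T_0)\times\partial D}=f,\qquad \partial_\nu u|_{(0,T_0)\times\partial D}=g .$$ Then the Dirichlet trace $u|_{(0,T_0)\times\partial B}$ of such a solution determines uniquely $u$ in $(0,T_0)\times\overline B$ and the normal derivative of $u$ on $(0,T_0)\times\partial B$. That is: if $u_1,u_2$ are solutions of the wave problem with data $(f_1,g_1)$ and $(f_2,g_2)$, which may be different, and $u_1,u_2$ have the same Dirichlet trace on $(0,T_0)\times\partial B$, then $u_1=u_2$ almost everywhere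 in $(0,T_0)\times\overline B$, and $u_1,u_2$ have the same normal derivative on $(0,T_0)\times\partial B$. Here traces on $\partial B$ are taken from inside $B$, and the normal derivative is the distribution $\partial_\nu u$ on $(0,T_0)\times\partial B$ ($\nu$ now the unit outer normal to $B$) given by Green's formula $$\langle\partial_\nu u,\varphi|_{(0,T_0)\times\partial B}\rangle=\int_0^{T_0}\!\!\int_B(\nabla u\cdot\nabla\varphi-\partial_tu\,\partial_t\varphi)\,dx\,dt,\qquad \varphi\in C_c^\infty((0,T_0)\times\mathbb R^3),$$ whose right-hand side depends only on the values of $\varphi$ on $(0,T_0)\times\partial B$. -/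

import Mathlib

open MeasureTheory Set Topology
open scoped NNReal ContDiff RealInnerProductSpace

namespace WaveProblem

/-- Euclidean three-space. -/
abbrev E3 : Type := EuclideanSpace ℝ (Fin 3)

/-! ### Geometry -/

/-- `ρ` is a smooth function that defines `D` near `x`: close to `x` the set `D` is `{ρ < 0}`, and
the gradient of `ρ` does not vanish at `x`. -/
def IsDefiningFunctionAt (D : Set E3) (x : E3) (ρ : E3 → ℝ) : Prop :=
  ContDiff ℝ ∞ ρ ∧ (∀ᶠ y in 𝓝 x, y ∈ D ↔ ρ y < 0) ∧ gradient ρ x ≠ 0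

/-- The open set `D` has a smooth boundary and lies locally on one side of it. -/
def HasSmoothBoundary (D : Set E3) : Prop :=
  ∀ x ∈ frontier D, ∃ ρ : E3 → ℝ, IsDefiningFunctionAt D x ρ

open Classical in
/-- The unit outer normal to `D` at a boundary point `x`, the normalized gradient of a defining
function (all defining functions give the same vector); it is `0` where there is none. -/
noncomputable def outerNormal (D : Set E3) (x : E3) : E3 :=
  if h : ∃ ρ : E3 → ℝ, IsDefiningFunctionAt D x ρ then
    ‖gradient h.choose x‖⁻¹ • gradient h.choose x
  else 0

/-- The space-time cylinder `(0,T) × Ω`. -/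
def cyl (T : ℝ) (Ω : Set E3) : Set (ℝ × E3) := Ioo 0 T ×ˢ Ω

/-- The measure `dt ⊗ dS` on the lateral surface `(0,T) × S`, where `dS` is the surface area
(the two-dimensional Hausdorff measure in its Euclidean normalization) of `S`. -/
noncomputable def lateral (T : ℝ) (S : Set E3) : Measure (ℝ × E3) :=
  (volume.restrict (Ioo 0 T)).prod ((μHE[2] : Measure E3).restrict S)

/-! ### Test functions and function spaces -/

/-- Smooth real functions on space-time with compact support contained in `U`. -/
def IsTest (U : Set (ℝ × E3)) (φ : ℝ × E3 → ℝ) : Prop :=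
  ContDiff ℝ ∞ φ ∧ HasCompactSupport φ ∧ tsupport φ ⊆ U

/-- The time derivative `∂ₜφ`. -/
noncomputable def dt (φ : ℝ × E3 → ℝ) (z : ℝ × E3) : ℝ := fderiv ℝ φ z (1, 0)

/-- The spatial derivative `∂ₑφ = e · ∇φ` in the direction `e`. -/
noncomputable def dx (φ : ℝ × E3 → ℝ) (z : ℝ × E3) (e : E3) : ℝ := fderiv ℝ φ z (0, e)

/-- `v ∈ L^∞(0,T; L²(Ω))`. -/
def MemLinftyL2 {F : Type*} [NormedAddCommGroup F] (T : ℝ) (Ω : Set E3) (v : ℝ × E3 → F) :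
    Prop :=
  AEStronglyMeasurable v (volume.restrict (cyl T Ω)) ∧
    ∃ C : ℝ≥0,
      ∀ᵐ t ∂(volume.restrict (Ioo 0 T)),
        eLpNorm (fun x => v (t, x)) 2 (volume.restrict Ω) ≤ C

/-- `ut` is the weak time derivative of `u` in `(0,T) × Ω`. -/
def IsWeakTimeDeriv (T : ℝ) (Ω : Set E3) (u ut : ℝ × E3 → ℝ) : Prop :=
  ∀ φ, IsTest (cyl T Ω) φ → ∫ z in cyl T Ω, u z * dt φ z = -∫ z in cyl T Ω, ut z * φ z

/-- `G` is the weak spatial gradient of `u` in `(0,T) × Ω`. -/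
def IsWeakGradient (T : ℝ) (Ω : Set E3) (u : ℝ × E3 → ℝ) (G : ℝ × E3 → E3) : Prop :=
  ∀ φ, IsTest (cyl T Ω) φ → ∀ e : E3,
    ∫ z in cyl T Ω, u z * dx φ z e = -∫ z in cyl T Ω, ⟪G z, e⟫ * φ z

/-! ### Boundary values -/

/-- `h ∈ L²((0,T) × S)` is the Dirichlet trace on `(0,T) × S`, `S = ∂Ω`, of
`u ∈ L²(0,T; H¹(Ω))`, where `n` is the unit normal on `S` that points out of `Ω`: the Gauss formula
`∫_Ω (u ∂ₑφ + (e · ∇u) φ) dx = ∫_S h φ (e · n) dS`, integrated over `(0,T)`, holds for all `φ`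
that are smooth up to the boundary. -/
def HasTrace (T : ℝ) (Ω S : Set E3) (n : E3 → E3) (u h : ℝ × E3 → ℝ) : Prop :=
  MemLp u 2 (volume.restrict (cyl T Ω)) ∧ MemLp h 2 (lateral T S) ∧
    ∃ G : ℝ × E3 → E3, MemLp G 2 (volume.restrict (cyl T Ω)) ∧
      ∀ φ, IsTest (Ioo 0 T ×ˢ univ) φ → ∀ e : E3,
        ∫ z in cyl T Ω, (u z * dx φ z e + ⟪G z, e⟫ * φ z)
          = ∫ z, h z * φ z * ⟪n z.2, e⟫ ∂(lateral T S)

/-- `N` is the normal derivative (in the direction out of `Ω`) on `(0,T) × S`, `S = ∂Ω`, of a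
finite energy solution `u` of the wave equation in `(0,T) × Ω`, as a distribution on `(0,T) × S`:
`N φ` depends only on the values of the test function `φ` on `(0,T) × S`, and
`N φ = ∫∫ (∇u · ∇φ - ∂ₜu ∂ₜφ) dx dt`, which is Green's formula when `N φ = ∫∫ ∂ₙu φ dS dt`. -/
def IsNormalDeriv (T : ℝ) (Ω S : Set E3) (u : ℝ × E3 → ℝ) (N : (ℝ × E3 → ℝ) → ℝ) : Prop :=
  (∀ φ φ', IsTest (Ioo 0 T ×ˢ univ) φ → IsTest (Ioo 0 T ×ˢ univ) φ' →
    EqOn φ φ' (Ioo 0 T ×ˢ S) → N φ = N φ') ∧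
  ∃ (ut : ℝ × E3 → ℝ) (G : ℝ × E3 → E3),
    MemLp ut 2 (volume.restrict (cyl T Ω)) ∧ MemLp G 2 (volume.restrict (cyl T Ω)) ∧
    IsWeakTimeDeriv T Ω u ut ∧ IsWeakGradient T Ω u G ∧
    ∀ φ, IsTest (Ioo 0 T ×ˢ univ) φ →
      N φ = ∫ z in cyl T Ω, (dx φ z (G z) - ut z * dt φ z)

/-! ### The wave problem -/

/-- `u` solves, in the exterior `Ω = ℝ³ ∖ D̄` of the cavity `D` and on the time interval `(0,T)`,
the problem
`∂ₜ²u - Δu = 0` in `(0,T) × Ω`, `u = 0` and `∂ₜu = 0` at `t = 0`, `u = f` and `∂_ν u = g` on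
`(0,T) × ∂D`, with `ν` the unit outer normal to `D`,
in the class `u ∈ L^∞(0,T; H¹(Ω))`, `∂ₜu ∈ L^∞(0,T; L²(Ω))`, with `f, g ∈ L²((0,T) × ∂D)`.
Test functions that do not vanish at `t = 0` express the initial conditions, in the usual way. -/
def IsWaveSolution (T : ℝ) (D : Set E3) (f g u : ℝ × E3 → ℝ) : Prop :=
  ∃ (ut : ℝ × E3 → ℝ) (G : ℝ × E3 → E3),
    MemLinftyL2 T (closure D)ᶜ u ∧ MemLinftyL2 T (closure D)ᶜ ut ∧ MemLinftyL2 T (closure D)ᶜ G ∧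
    IsWeakGradient T (closure D)ᶜ u G ∧
    -- `ut` is the weak time derivative of `u`, and `u = 0` at `t = 0`
    (∀ φ, IsTest (Iio T ×ˢ (closure D)ᶜ) φ →
      ∫ z in cyl T (closure D)ᶜ, u z * dt φ z = -∫ z in cyl T (closure D)ᶜ, ut z * φ z) ∧
    -- the wave equation, and `∂ₜu = 0` at `t = 0`
    (∀ φ, IsTest (Iio T ×ˢ (closure D)ᶜ) φ →
      ∫ z in cyl T (closure D)ᶜ, (ut z * dt φ z - dx φ z (G z)) = 0) ∧
    -- `u = f` on the lateral boundary; the normal that points out of `Ω` is `-ν`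
    HasTrace T (closure D)ᶜ (frontier D) (fun x => -outerNormal D x) u f ∧
    -- `∂_ν u = g` on the lateral boundary
    MemLp g 2 (lateral T (frontier D)) ∧
    IsNormalDeriv T (closure D)ᶜ (frontier D) u (fun φ => -∫ z, g z * φ z ∂(lateral T (frontier D)))

/-- `h` is the Dirichlet trace of `u` on `(0,T) × ∂B`, where `B` is the open ball `B(p,r)`. -/
def HasSphereTrace (T : ℝ) (p : E3) (r : ℝ) (u h : ℝ × E3 → ℝ) : Prop :=
  HasTrace T (Metric.ball p r) (Metric.sphere p r) (fun x => r⁻¹ • (x - p)) u h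

/-- `N` is the derivative of `u` in the direction of the unit outer normal to the open ball
`B = B(p,r)`, as a distribution on `(0,T) × ∂B`. -/
def IsSphereNormalDeriv (T : ℝ) (p : E3) (r : ℝ) (u : ℝ × E3 → ℝ) (N : (ℝ × E3 → ℝ) → ℝ) :
    Prop :=
  IsNormalDeriv T (Metric.ball p r) (Metric.sphere p r) u N

end WaveProblem

open WaveProblem

/-! The difference `w` of the two solutions, restricted to the ball, solves the wave equation with
zero initial values and zero Dirichlet trace on the sphere. The classical energy identity multiplies
the equation by `∂ₜw`, but `∂ₜw` has no spatial derivative here. The remedy is to integrate the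
equation once in time. With `g = ∂ₜw`, `G = ∇w` and `P` the time primitive from `0`, one has `w = P
g` and, weakly, `g = div (P G)`. Testing this with `w` on `(0,s)` gives `½ ∫ w(s)² + ½ ∫ |P G (s)|²
= 0`, because both integrands are half the time derivative of a square. Hence `w = 0`
(`ae_eq_zero_of_weak_wave`).

Two points need care. The function `w` cut off at time `s` is not a test function. It jumps at `s`,
but the integrated equation involves only spatial derivatives, and by the zero trace its extension
by zero has spatial derivatives in `L²` (`integral_indicator_mul_dx`). Since the cylinder is convex,
dilating by a factor `k > 1` about an interior point pulls the support inside, and mollification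
then yields genuine test functions that converge weakly (`integral_add_sum_eq_zero_of_forall_test`).
The integrated equation itself comes from inserting backward time primitives of test functions,
which need not vanish at `t = 0` (`IsTest.exists_primitive`).

For the normal derivative, equality in the ball makes the two Green functionals agree. That the
functional depends only on values on the sphere follows by cutting off near the sphere: a test
function that vanishes there is bounded by the distance to it, which compensates the large gradient
of the cutoff (`integral_eq_zero_of_eqOn_sphere`). -/

open Filter

/-! ### Cauchy–Schwarz for real square integrable functions -/

section L2

variable {α : Type*} [MeasurableSpace α] {μ : Measure α}

lemma abs_integral_mul_le_sqrt_mul_sqrt {f g : α → ℝ} (hf : MemLp f 2 μ) (hg : MemLp g 2 μ) :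
    |∫ x, f x * g x ∂μ| ≤ √(∫ x, f x ^ 2 ∂μ) * √(∫ x, g x ^ 2 ∂μ) := by
  have key : ∀ {h k : α → ℝ} (hh : MemLp h 2 μ) (hk : MemLp k 2 μ),
      inner ℝ (hh.toLp h) (hk.toLp k) = ∫ x, h x * k x ∂μ := by
    intro h k hh hk
    rw [L2.inner_def]
    refine integral_congr_ae ?_
    filter_upwards [hh.coeFn_toLp, hk.coeFn_toLp] with x h1 h2
    rw [h1, h2, real_inner_eq_re_inner, RCLike.inner_apply]
    simp [mul_comm]
  have hn : ∀ {h : α → ℝ} (hh : MemLp h 2 μ), ‖hh.toLp h‖ = √(∫ x, h x ^ 2 ∂μ) := by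
    intro h hh
    rw [norm_eq_sqrt_real_inner, key hh hh]
    simp [pow_two]
  rw [← key hf hg, ← hn hf, ← hn hg]
  exact abs_real_inner_le_norm _ _

end L2

/-! ### Dilated translates and their weak continuity in `L²` -/

section Dilation

variable {E : Type*} [NormedAddCommGroup E] [NormedSpace ℝ E] [FiniteDimensional ℝ E]
  [MeasurableSpace E] [BorelSpace E] (μ : Measure E) [μ.IsAddHaarMeasure]

lemma integral_comp_dilation {F : Type*} [NormedAddCommGroup F] [NormedSpace ℝ F] (f : E → F)
    (c t : E) {k : ℝ} (hk : 0 ≤ k) :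
    ∫ z, f (c + k • (z - t - c)) ∂μ = (k ^ Module.finrank ℝ E)⁻¹ • ∫ z, f z ∂μ := by
  have h1 := Measure.integral_comp_smul_of_nonneg μ (fun y => f (c + y)) k (hR := hk)
  rw [integral_add_left_eq_self] at h1
  rw [← h1, ← integral_sub_right_eq_self (fun z => f (c + k • z)) (t + c)]
  simp [sub_sub]

lemma integral_comp_dilation_sub {F : Type*} [NormedAddCommGroup F] [NormedSpace ℝ F] (f : E → F)
    (c z : E) {k : ℝ} (hk : 0 ≤ k) :
    ∫ t, f (c + k • (z - t - c)) ∂μ = (k ^ Module.finrank ℝ E)⁻¹ • ∫ z, f z ∂μ := by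
  rw [← integral_comp_dilation μ f c c hk,
    ← integral_sub_left_eq_self (fun t => f (c + k • (t - c - c))) μ (z + c)]
  congr 1 with t
  congr 3
  abel

variable {μ}

lemma MeasureTheory.Integrable.comp_dilation {F : Type*} [NormedAddCommGroup F] [NormedSpace ℝ F]
    {f : E → F} (hf : Integrable f μ) (c t : E) {k : ℝ} (hk : 0 < k) :
    Integrable (fun z => f (c + k • (z - t - c))) μ := by
  have h1 := (hf.comp_add_left c).comp_smul hk.ne'
  have := h1.comp_sub_right (t + c)
  simpa [sub_sub] using this

lemma MeasureTheory.MemLp.comp_dilation {f : E → ℝ} (hfm : StronglyMeasurable f)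
    (hf : MemLp f 2 μ) (c t : E) {k : ℝ} (hk : 0 < k) :
    MemLp (fun z => f (c + k • (z - t - c))) 2 μ := by
  have hm := hfm.comp_measurable (show Continuous fun z : E => c + k • (z - t - c) by fun_prop).measurable
  refine (memLp_two_iff_integrable_sq hm.aestronglyMeasurable).2 ?_
  exact hf.integrable_sq.comp_dilation c t hk

/-- Averages of dilated translates converge weakly in `L²`: the pairing is jointly continuous in
the dilation factor and the translation. -/
lemma tendsto_integral_mul_comp_dilation {a U : E → ℝ} (ha : MemLp a 2 μ)
    (hUm : StronglyMeasurable U) (hU : MemLp U 2 μ) (hU1 : Integrable U μ) (c : E) :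
    Tendsto (fun q : ℝ × E => ∫ z, a z * U (c + q.1 • (z - q.2 - c)) ∂μ)
      (𝓝[≥] 1 ×ˢ 𝓝 0) (𝓝 (∫ z, a z * U z ∂μ)) := by
  have hfil : (𝓝[≥] (1:ℝ) ×ˢ 𝓝 (0:E)) ≤ 𝓝 ((1:ℝ), (0:E)) := by
    rw [nhds_prod_eq]; exact Filter.prod_mono nhdsWithin_le_nhds le_rfl
  have hge : ∀ᶠ q : ℝ × E in 𝓝[≥] 1 ×ˢ 𝓝 0, 1 ≤ q.1 :=
    (tendsto_fst (f := 𝓝[≥] (1:ℝ)) (g := 𝓝 (0:E))).eventually eventually_mem_nhdsWithin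
  -- the case of continuous compactly supported `b`
  have hcont : ∀ b : E → ℝ, Continuous b → HasCompactSupport b →
      Tendsto (fun q : ℝ × E => ∫ z, b z * U (c + q.1 • (z - q.2 - c)) ∂μ)
        (𝓝[≥] 1 ×ˢ 𝓝 0) (𝓝 (∫ z, b z * U z ∂μ)) := by
    intro b hb hbs
    obtain ⟨M, hM⟩ := hbs.exists_bound_of_continuous hb
    -- The substitution `y = c + k (z - t - c)` moves the dilation onto the continuous factor `b`,
    -- where pointwise convergence is available; `U` is only measurable.
    have hform : ∀ᶠ q : ℝ × E in 𝓝[≥] 1 ×ˢ 𝓝 0,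
        (q.1 ^ Module.finrank ℝ E)⁻¹ * ∫ y, b (c + q.2 + q.1⁻¹ • (y - c)) * U y ∂μ
          = ∫ z, b z * U (c + q.1 • (z - q.2 - c)) ∂μ := by
      filter_upwards [hge] with q hq
      have hq0 : q.1 ≠ 0 := by positivity
      have := integral_comp_dilation μ (fun y => b (c + q.2 + q.1⁻¹ • (y - c)) * U y) c q.2
        (k := q.1) (by positivity)
      rw [smul_eq_mul] at this
      rw [← this]
      congr 1 with z
      congr 2
      rw [add_sub_cancel_left, smul_smul, inv_mul_cancel₀ hq0, one_smul]
      abel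
    refine Tendsto.congr' hform ?_
    have h1 : Tendsto (fun q : ℝ × E => (q.1 ^ Module.finrank ℝ E)⁻¹) (𝓝[≥] 1 ×ˢ 𝓝 0) (𝓝 1) := by
      have : ContinuousAt (fun q : ℝ × E => (q.1 ^ Module.finrank ℝ E)⁻¹) ((1:ℝ), (0:E)) := by
        refine ContinuousAt.inv₀ (by fun_prop) (by simp)
      simpa using this.tendsto.mono_left hfil
    have h2 : Tendsto (fun q : ℝ × E => ∫ y, b (c + q.2 + q.1⁻¹ • (y - c)) * U y ∂μ)
        (𝓝[≥] 1 ×ˢ 𝓝 0) (𝓝 (∫ z, b z * U z ∂μ)) := by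
      refine tendsto_integral_filter_of_dominated_convergence (fun y => M * ‖U y‖) ?_ ?_ ?_ ?_
      · refine Eventually.of_forall fun q => ?_
        have : Continuous fun y => b (c + q.2 + q.1⁻¹ • (y - c)) := by fun_prop
        exact this.aestronglyMeasurable.mul hUm.aestronglyMeasurable
      · refine Eventually.of_forall fun q => Eventually.of_forall fun y => ?_
        rw [norm_mul]
        exact mul_le_mul_of_nonneg_right (hM _) (norm_nonneg _)
      · exact hU1.norm.const_mul M
      · refine Eventually.of_forall fun y => ?_
        have : ContinuousAt (fun q : ℝ × E => b (c + q.2 + q.1⁻¹ • (y - c))) ((1:ℝ), (0:E)) := by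
          have hi : ContinuousAt (fun q : ℝ × E => q.1⁻¹) ((1:ℝ), (0:E)) :=
            ContinuousAt.inv₀ (by fun_prop) (by simp)
          refine hb.continuousAt.comp ?_
          exact (continuousAt_const.add continuousAt_snd).add (hi.smul continuousAt_const)
        have := this.tendsto.mono_left hfil
        simp only [add_zero, inv_one, one_smul, add_sub_cancel] at this
        exact this.mul_const _
    simpa using h1.mul h2
  rw [Metric.tendsto_nhds]
  intro ε hε
  set N := √(∫ z, U z ^ 2 ∂μ) with hN
  have hN0 : 0 ≤ N := Real.sqrt_nonneg _
  -- Replacing `a` by `b` costs at most `δ N ≤ ε / 4`, once at `q` and once at the limit; the `+ 1`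
  -- covers `N = 0`.
  set δ := ε / (4 * (N + 1)) with hδ
  have hδ0 : 0 < δ := by positivity
  obtain ⟨b, hbs, hb2, hbc, hbm⟩ := ha.exists_hasCompactSupport_eLpNorm_sub_le
    (ε := ENNReal.ofReal δ) (by simp) (by simpa using hδ0)
  have hd : MemLp (fun z => a z - b z) 2 μ := ha.sub hbm
  have hdn : √(∫ z, (a z - b z) ^ 2 ∂μ) ≤ δ := by
    have h1 := hd.eLpNorm_eq_integral_rpow_norm (by simp) (by simp)
    have h2 : eLpNorm (fun z => a z - b z) 2 μ ≤ ENNReal.ofReal δ := hb2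
    rw [h1, ENNReal.ofReal_le_ofReal_iff hδ0.le] at h2
    convert h2 using 1
    rw [Real.sqrt_eq_rpow]
    simp
  have hsmall : ∀ q : ℝ × E, 1 ≤ q.1 →
      |∫ z, (a z - b z) * U (c + q.1 • (z - q.2 - c)) ∂μ| ≤ ε / 4 := by
    intro q hq
    have hq0 : 0 < q.1 := by positivity
    refine (abs_integral_mul_le_sqrt_mul_sqrt hd (hU.comp_dilation hUm c q.2 hq0)).trans ?_
    -- A dilation factor of at least `1` does not increase the `L²` norm, so the error bound is
    -- uniform in `q`.
    have h2 : √(∫ z, U (c + q.1 • (z - q.2 - c)) ^ 2 ∂μ) ≤ N := by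
      refine Real.sqrt_le_sqrt ?_
      rw [integral_comp_dilation μ (fun y => U y ^ 2) c q.2 hq0.le, smul_eq_mul]
      refine mul_le_of_le_one_left (integral_nonneg fun z => sq_nonneg _) ?_
      exact inv_le_one_of_one_le₀ (one_le_pow₀ hq)
    calc _ ≤ δ * N := mul_le_mul hdn h2 (Real.sqrt_nonneg _) hδ0.le
      _ ≤ δ * (N + 1) := by gcongr; linarith
      _ = ε / 4 := by rw [hδ]; field_simp
  have hsplit : ∀ q : ℝ × E, 1 ≤ q.1 → ∫ z, a z * U (c + q.1 • (z - q.2 - c)) ∂μ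
      = (∫ z, (a z - b z) * U (c + q.1 • (z - q.2 - c)) ∂μ)
        + ∫ z, b z * U (c + q.1 • (z - q.2 - c)) ∂μ := by
    intro q hq
    have hUq := hU.comp_dilation hUm c q.2 (show 0 < q.1 by positivity)
    refine Eq.trans ?_ (integral_add (hd.integrable_mul hUq) (hbm.integrable_mul hUq))
    congr 1 with z
    ring
  have h10 : ∀ z : E, c + (1:ℝ) • (z - 0 - c) = z := by intro z; simp
  have h0 := hsmall (1, 0) le_rfl
  have h0' := hsplit (1, 0) le_rfl
  simp only [h10] at h0 h0'
  filter_upwards [hge, (Metric.tendsto_nhds.1 (hcont b hbc hbs)) (ε / 4) (by positivity)]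
    with q hq hq2
  have := hsmall q hq
  rw [Real.dist_eq] at hq2 ⊢
  rw [hsplit q hq, h0']
  rw [abs_le] at *
  rw [abs_lt] at *
  constructor <;> linarith [this.1, this.2, h0.1, h0.2, hq2.1, hq2.2]

end Dilation

/-! ### Mollification after dilation, and extension of weak identities beyond test functions -/

section Mollification

variable {E : Type*} [NormedAddCommGroup E] [NormedSpace ℝ E] [FiniteDimensional ℝ E]
  [MeasurableSpace E] [BorelSpace E] (μ : Measure E) [μ.IsAddHaarMeasure]

/-- The mollification, with kernel `φ`, of `U` composed with the dilation by `k` about `c`. -/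
noncomputable def dilationMollify (φ : ContDiffBump (0 : E)) (c : E) (k : ℝ) (U : E → ℝ) : E → ℝ :=
  convolution (φ.normed μ) (fun y => U (c + k • (y - c))) (ContinuousLinearMap.lsmul ℝ ℝ) μ

variable {μ}

set_option linter.unusedSectionVars false in
lemma dilationMollify_apply (φ : ContDiffBump (0 : E)) (c : E) (k : ℝ) (U : E → ℝ) (z : E) :
    dilationMollify μ φ c k U z = ∫ t, φ.normed μ t * U (c + k • (z - t - c)) ∂μ := rfl

lemma MeasureTheory.Integrable.comp_dilation' {U : E → ℝ} (hU : Integrable U μ) (c : E) {k : ℝ}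
    (hk : 0 < k) : Integrable (fun y => U (c + k • (y - c))) μ := by
  simpa using hU.comp_dilation c 0 hk

lemma contDiff_dilationMollify (φ : ContDiffBump (0 : E)) (c : E) {k : ℝ} (hk : 0 < k) {U : E → ℝ}
    (hU : Integrable U μ) : ContDiff ℝ ∞ (dilationMollify μ φ c k U) :=
  φ.hasCompactSupport_normed.contDiff_convolution_left _ φ.contDiff_normed
    (hU.comp_dilation' c hk).locallyIntegrable

/-- Mollification after dilation turns a weak derivative into a classical one. -/
lemma fderiv_dilationMollify (φ : ContDiffBump (0 : E)) (c : E) {k : ℝ} (hk : 0 < k)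
    {U H : E → ℝ} (hU : Integrable U μ) (v : E)
    (hUH : ∀ ψ : E → ℝ, ContDiff ℝ ∞ ψ → HasCompactSupport ψ →
      ∫ z, U z * fderiv ℝ ψ z v ∂μ = -∫ z, H z * ψ z ∂μ) (z : E) :
    fderiv ℝ (dilationMollify μ φ c k U) z v = k * dilationMollify μ φ c k H z := by
  have hφ1 : ContDiff ℝ ∞ (φ.normed μ) := φ.contDiff_normed
  have hloc : LocallyIntegrable (fun y => U (c + k • (y - c))) μ :=
    (hU.comp_dilation' c hk).locallyIntegrable
  have hd := φ.hasCompactSupport_normed.hasFDerivAt_convolution_left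
    (ContinuousLinearMap.lsmul ℝ ℝ) (φ.contDiff_normed (μ := μ) (n := 1)) hloc z
  have hd2 : fderiv ℝ (dilationMollify μ φ c k U) z v
      = ∫ t, fderiv ℝ (φ.normed μ) t v * U (c + k • (z - t - c)) ∂μ := by
    unfold dilationMollify
    rw [hd.fderiv, convolution_def, ContinuousLinearMap.integral_apply]
    · rfl
    · have hc : ConvolutionExistsAt (fderiv ℝ (φ.normed μ)) (fun y => U (c + k • (y - c))) z
          ((ContinuousLinearMap.lsmul ℝ ℝ).precompL E) μ :=
        ((φ.hasCompactSupport_normed (μ := μ)).fderiv (𝕜 := ℝ)).convolutionExists_left _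
          (hφ1.continuous_fderiv (by simp)) hloc z
      exact hc
  have hk0 : k ≠ 0 := hk.ne'
  have harg : ∀ t : E, z - (c + k⁻¹ • ((c + k • (z - t - c)) - c)) = t := by
    intro t
    rw [add_sub_cancel_left, smul_smul, inv_mul_cancel₀ hk0, one_smul]
    abel
  -- The kernel seen from the undilated variable: `t = z - (c + k⁻¹ (y - c))`. Its derivative
  -- carries the factor `-k⁻¹`, which is the source of the factor `k` in the conclusion.
  set ζ : E → ℝ := fun y => φ.normed μ (z - (c + k⁻¹ • (y - c))) with hζ
  have hζ1 : ContDiff ℝ ∞ ζ := by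
    refine hφ1.comp ?_
    fun_prop
  have hζ2 : HasCompactSupport ζ := by
    refine HasCompactSupport.of_support_subset_isCompact
      ((φ.hasCompactSupport_normed (μ := μ)).isCompact.image
        (f := fun t => c + k • (z - t - c)) (by fun_prop)) ?_
    intro y hy
    refine ⟨z - (c + k⁻¹ • (y - c)), subset_tsupport _ hy, ?_⟩
    simp only [sub_sub_cancel, add_sub_cancel_left, smul_smul, mul_inv_cancel₀ hk0, one_smul]
    abel
  have hζd : ∀ y, fderiv ℝ ζ y v = -k⁻¹ * fderiv ℝ (φ.normed μ) (z - (c + k⁻¹ • (y - c))) v := by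
    intro y
    have h1 : HasFDerivAt (fun y : E => z - (c + k⁻¹ • (y - c)))
        (-(k⁻¹ • ContinuousLinearMap.id ℝ E)) y := by
      have := (((hasFDerivAt_id (𝕜 := ℝ) y).sub_const c).const_smul k⁻¹).const_add c
      exact this.const_sub z
    have h2 := (hφ1.differentiable (by simp) (z - (c + k⁻¹ • (y - c)))).hasFDerivAt.comp y h1
    have h3 : fderiv ℝ ζ y = _ := h2.fderiv
    rw [h3]
    simp
  have h := hUH ζ hζ1 hζ2
  simp only [hζd] at h
  have e1 := integral_comp_dilation_sub μ
    (fun y => fderiv ℝ (φ.normed μ) (z - (c + k⁻¹ • (y - c))) v * U y) c z hk.le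
  have e2 := integral_comp_dilation_sub μ
    (fun y => φ.normed μ (z - (c + k⁻¹ • (y - c))) * H y) c z hk.le
  simp only [harg] at e1 e2
  rw [hd2, dilationMollify_apply, e1, e2]
  have h' : ∫ y, fderiv ℝ (φ.normed μ) (z - (c + k⁻¹ • (y - c))) v * U y ∂μ
      = k * ∫ y, φ.normed μ (z - (c + k⁻¹ • (y - c))) * H y ∂μ := by
    have h4 : ∫ y, U y * (-k⁻¹ * fderiv ℝ (φ.normed μ) (z - (c + k⁻¹ • (y - c))) v) ∂μ
        = -k⁻¹ * ∫ y, fderiv ℝ (φ.normed μ) (z - (c + k⁻¹ • (y - c))) v * U y ∂μ := by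
      rw [← integral_const_mul]; congr 1 with y; ring
    have h5 : ∫ y, H y * ζ y ∂μ = ∫ y, φ.normed μ (z - (c + k⁻¹ • (y - c))) * H y ∂μ := by
      congr 1 with y; rw [mul_comm]
    rw [h4, h5] at h
    calc _ = -k * (-k⁻¹ * ∫ y, fderiv ℝ (φ.normed μ) (z - (c + k⁻¹ • (y - c))) v * U y ∂μ) := by
          field_simp
      _ = _ := by rw [h]; ring
  rw [h', smul_eq_mul, smul_eq_mul]
  ring

/-- For dilation factors `k > 1` and small kernels, the mollification of a function that vanishes
off a bounded open convex set has compact support in this set. -/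
lemma exists_tsupport_dilationMollify_subset {C : Set E} (hCo : IsOpen C) (hCc : Convex ℝ C)
    (hCb : Bornology.IsBounded C) {c : E} (hc : c ∈ C) {k : ℝ} (hk : 1 < k) :
    ∃ δ > 0, ∀ (φ : ContDiffBump (0 : E)), φ.rOut ≤ δ → ∀ U : E → ℝ, (∀ z ∉ C, U z = 0) →
      HasCompactSupport (dilationMollify μ φ c k U) ∧ tsupport (dilationMollify μ φ c k U) ⊆ C := by
  have hk0 : 0 < k := by linarith
  set K : Set E := (fun y => c + k⁻¹ • (y - c)) '' closure C with hK
  have hKc : IsCompact K := hCb.isCompact_closure.image (by fun_prop)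
  -- In a convex set, a proper combination of an interior point and a point of the closure is
  -- interior; `k⁻¹ < 1` gives positive weight to `c`.
  have hKC : K ⊆ C := by
    rintro _ ⟨y, hy, rfl⟩
    have := hCc.combo_interior_closure_mem_interior (a := 1 - k⁻¹) (b := k⁻¹)
      (hCo.interior_eq.symm ▸ hc) hy (by simpa using inv_lt_one_of_one_lt₀ hk) (by positivity)
      (by ring)
    rw [hCo.interior_eq] at this
    convert this using 1
    module
  obtain ⟨δ, hδ, hδC⟩ := hKc.exists_cthickening_subset_open hCo hKC
  refine ⟨δ, hδ, fun φ hφ U hU => ?_⟩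
  have hsub : Function.support (dilationMollify μ φ c k U) ⊆ Metric.cthickening δ K := by
    intro z hz
    by_contra hzn
    refine hz ?_
    rw [dilationMollify_apply]
    refine integral_eq_zero_of_ae (Eventually.of_forall fun t => ?_)
    by_cases ht : t ∈ Metric.ball (0 : E) φ.rOut
    · have : c + k • (z - t - c) ∉ C := by
        intro hmem
        refine hzn (Metric.mem_cthickening_of_dist_le z (z - t) δ K ?_ ?_)
        · refine ⟨_, subset_closure hmem, ?_⟩
          simp only [add_sub_cancel_left, smul_smul, inv_mul_cancel₀ hk0.ne', one_smul]
          abel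
        · simp only [Metric.mem_ball, dist_zero_right] at ht
          rw [dist_eq_norm]
          simpa using (ht.le.trans hφ)
      simp [hU _ this]
    · have : φ.normed μ t = 0 := by
        rw [← Function.notMem_support, φ.support_normed_eq]; exact ht
      simp [this]
  have hts : tsupport (dilationMollify μ φ c k U) ⊆ Metric.cthickening δ K :=
    closure_minimal hsub Metric.isClosed_cthickening
  exact ⟨HasCompactSupport.of_support_subset_isCompact hKc.cthickening hsub, hts.trans hδC⟩

/-- By Fubini, a pairing with a mollification is the kernel average of the pairings with dilated
translates, so convergence reduces to the joint continuity of those pairings. -/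
lemma integral_mul_dilationMollify (φ : ContDiffBump (0 : E)) (c : E) {k : ℝ} (hk : 0 < k)
    {a U : E → ℝ} (ham : StronglyMeasurable a) (ha : MemLp a 2 μ) (hUm : StronglyMeasurable U)
    (hU : MemLp U 2 μ) :
    ∫ z, a z * dilationMollify μ φ c k U z ∂μ
      = ∫ t, φ.normed μ t * ∫ z, a z * U (c + k • (z - t - c)) ∂μ ∂μ := by
  have hφi : Integrable (φ.normed μ) μ := φ.integrable_normed
  have hφc : Continuous (φ.normed μ) := φ.continuous_normed
  -- Domination by `a² φ + φ U²`, from `2 |x y| ≤ x² + y²` and the nonnegativity of the kernel.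
  have hi : Integrable (fun q : E × E => a q.1 * (φ.normed μ q.2 * U (c + k • (q.1 - q.2 - c))))
      (μ.prod μ) := by
    have i1 : Integrable (fun q : E × E => a q.1 ^ 2 * φ.normed μ q.2) (μ.prod μ) :=
      ha.integrable_sq.mul_prod hφi
    have i2 : Integrable (fun q : E × E => φ.normed μ q.2 * U (c + k • (q.1 - q.2 - c)) ^ 2)
        (μ.prod μ) :=
      hφi.convolution_integrand (ContinuousLinearMap.lsmul ℝ ℝ)
        (hU.integrable_sq.comp_dilation' c hk)
    refine (i1.add i2).mono' ?_ (Eventually.of_forall fun q => ?_)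
    · have h1 : StronglyMeasurable fun q : E × E => a q.1 := ham.comp_measurable measurable_fst
      have h2 : StronglyMeasurable fun q : E × E => φ.normed μ q.2 :=
        hφc.stronglyMeasurable.comp_measurable measurable_snd
      have h3 : StronglyMeasurable fun q : E × E => U (c + k • (q.1 - q.2 - c)) := by
        refine hUm.comp_measurable (Continuous.measurable ?_)
        fun_prop
      exact (h1.mul (h2.mul h3)).aestronglyMeasurable
    · have hn : 0 ≤ φ.normed μ q.2 := φ.nonneg_normed _
      rw [Real.norm_eq_abs, abs_le]
      simp only [Pi.add_apply]
      set x := a q.1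
      set y := U (c + k • (q.1 - q.2 - c))
      constructor
      · nlinarith [mul_nonneg hn (sq_nonneg (x + y)), mul_nonneg hn (sq_nonneg x),
          mul_nonneg hn (sq_nonneg y)]
      · nlinarith [mul_nonneg hn (sq_nonneg (x - y)), mul_nonneg hn (sq_nonneg x),
          mul_nonneg hn (sq_nonneg y)]
  have h1 := integral_integral_swap
    (f := fun z t => a z * (φ.normed μ t * U (c + k • (z - t - c)))) hi
  simp only [integral_const_mul] at h1
  simp only [dilationMollify_apply]
  rw [h1]
  congr 1 with t
  rw [← integral_const_mul]
  congr 1 with z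
  ring

/-- Weak convergence is enough for the passage to the limit, because the other factor `a` stays
fixed. -/
lemma tendsto_integral_mul_dilationMollify {φ : ℕ → ContDiffBump (0 : E)}
    (hφ : Tendsto (fun n => (φ n).rOut) atTop (𝓝 0)) (c : E) {k : ℕ → ℝ} (hk1 : ∀ n, 1 < k n)
    (hk : Tendsto k atTop (𝓝 1)) {a U : E → ℝ} (ham : StronglyMeasurable a) (ha : MemLp a 2 μ)
    (hUm : StronglyMeasurable U) (hU : MemLp U 2 μ) (hU1 : Integrable U μ) :
    Tendsto (fun n => ∫ z, a z * dilationMollify μ (φ n) c (k n) U z ∂μ) atTop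
      (𝓝 (∫ z, a z * U z ∂μ)) := by
  have hlim := tendsto_integral_mul_comp_dilation ha hUm hU hU1 c
  have hkk : Tendsto k atTop (𝓝[≥] 1) :=
    tendsto_nhdsWithin_iff.2 ⟨hk, Eventually.of_forall fun n => (hk1 n).le⟩
  have hneg : Tendsto (fun s : E => -s) (𝓝 0) (𝓝 0) := by
    simpa using (continuous_neg (G := E)).tendsto 0
  -- The average is a convolution at the point `0`, which evaluates its second factor at `0 - t`;
  -- hence the reflected argument `-s`.
  have hg := ContDiffBump.convolution_tendsto_right (μ := μ)
    (g := fun n s => ∫ z, a z * U (c + k n • (z - -s - c)) ∂μ) (k := fun _ => 0) hφ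
    (Eventually.of_forall fun n => by
      refine (StronglyMeasurable.integral_prod_right' (f := fun q : E × E =>
        a q.2 * U (c + k n • (q.2 - -q.1 - c))) ?_).aestronglyMeasurable
      have h1 : StronglyMeasurable fun q : E × E => a q.2 := ham.comp_measurable measurable_snd
      have h3 : StronglyMeasurable fun q : E × E => U (c + k n • (q.2 - -q.1 - c)) := by
        refine hUm.comp_measurable (Continuous.measurable ?_)
        fun_prop
      exact h1.mul h3)
    (hlim.comp (hkk.prodMap hneg)) tendsto_const_nhds
  refine hg.congr fun n => ?_
  rw [integral_mul_dilationMollify (φ n) c (by linarith [hk1 n]) ham ha hUm hU, convolution_def]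
  simp

/-- A first order identity that holds for test functions in a bounded open convex set `C` extends
to the square integrable functions on `C` whose extension by zero has weak derivatives in `L²`. -/
theorem integral_add_sum_eq_zero_of_forall_test {ι : Type*} [Fintype ι] {C : Set E}
    (hCo : IsOpen C) (hCc : Convex ℝ C) (hCb : Bornology.IsBounded C) (hCn : C.Nonempty)
    (v : ι → E) {a U : E → ℝ} {b H : ι → E → ℝ}
    (ham : StronglyMeasurable a) (ha : MemLp a 2 μ)
    (hbm : ∀ i, StronglyMeasurable (b i)) (hb : ∀ i, MemLp (b i) 2 μ)
    (hUm : StronglyMeasurable U) (hU : MemLp U 2 μ) (hU0 : ∀ z ∉ C, U z = 0)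
    (hHm : ∀ i, StronglyMeasurable (H i)) (hH : ∀ i, MemLp (H i) 2 μ)
    (hH0 : ∀ i, ∀ z ∉ C, H i z = 0)
    (hUH : ∀ i, ∀ ψ : E → ℝ, ContDiff ℝ ∞ ψ → HasCompactSupport ψ →
      ∫ z, U z * fderiv ℝ ψ z (v i) ∂μ = -∫ z, H i z * ψ z ∂μ)
    (hab : ∀ ψ : E → ℝ, ContDiff ℝ ∞ ψ → HasCompactSupport ψ → tsupport ψ ⊆ C →
      ∫ z, a z * ψ z ∂μ + ∑ i, ∫ z, b i z * fderiv ℝ ψ z (v i) ∂μ = 0) :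
    ∫ z, a z * U z ∂μ + ∑ i, ∫ z, b i z * H i z ∂μ = 0 := by
  obtain ⟨c, hc⟩ := hCn
  have hint : ∀ {f : E → ℝ}, MemLp f 2 μ → (∀ z ∉ C, f z = 0) → Integrable f μ := by
    intro f hf hf0
    have : IntegrableOn f C μ :=
      haveI : IsFiniteMeasure (μ.restrict C) := ⟨by simpa using hCb.measure_lt_top⟩
      (hf.restrict C).integrable (by norm_num)
    exact (integrableOn_iff_integrable_of_support_subset
      (fun z hz => by_contra fun h => hz (hf0 z h))).1 this
  set k : ℕ → ℝ := fun n => 1 + 1 / ((n : ℝ) + 1) with hkdef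
  have hk1 : ∀ n, 1 < k n := fun n => by simp only [hkdef]; linarith [Nat.one_div_pos_of_nat (α := ℝ) (n := n)]
  have hk0 : ∀ n, 0 < k n := fun n => by linarith [hk1 n]
  have hk : Tendsto k atTop (𝓝 1) := by
    simpa [hkdef] using (tendsto_one_div_add_atTop_nhds_zero_nat (𝕜 := ℝ)).const_add 1
  choose δ hδ hsupp using fun n =>
    exists_tsupport_dilationMollify_subset (μ := μ) hCo hCc hCb hc (hk1 n)
  set ρ : ℕ → ℝ := fun n => min (δ n) (1 / ((n : ℝ) + 1)) with hρ
  have hρ0 : ∀ n, 0 < ρ n := fun n => lt_min (hδ n) Nat.one_div_pos_of_nat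
  let φ : ℕ → ContDiffBump (0 : E) := fun n => ⟨ρ n / 2, ρ n, by linarith [hρ0 n], by linarith [hρ0 n]⟩
  have hφ : Tendsto (fun n => (φ n).rOut) atTop (𝓝 0) := by
    refine squeeze_zero (fun n => (hρ0 n).le) (fun n => min_le_right _ _)
      (tendsto_one_div_add_atTop_nhds_zero_nat (𝕜 := ℝ))
  -- The mollified dilate of `U` is an admissible test function in `C`; differentiation brings out
  -- `k n`, which disappears in the limit.
  have hzero : ∀ n, ∫ z, a z * dilationMollify μ (φ n) c (k n) U z ∂μ
      + ∑ i, k n * ∫ z, b i z * dilationMollify μ (φ n) c (k n) (H i) z ∂μ = 0 := by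
    intro n
    obtain ⟨h1, h2⟩ := hsupp n (φ n) (min_le_left _ _) U hU0
    rw [← hab _ (contDiff_dilationMollify (φ n) c (hk0 n) (hint hU hU0)) h1 h2]
    congr 1
    refine Finset.sum_congr rfl fun i _ => ?_
    rw [← integral_const_mul]
    congr 1 with z
    rw [fderiv_dilationMollify (φ n) c (hk0 n) (hint hU hU0) (v i) (hUH i)]
    ring
  have hl := (tendsto_integral_mul_dilationMollify hφ c hk1 hk ham ha hUm hU (hint hU hU0)).add
    (tendsto_finsetSum Finset.univ fun i _ => hk.mul
      (tendsto_integral_mul_dilationMollify hφ c hk1 hk (hbm i) (hb i) (hHm i) (hH i)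
        (hint (hH i) (hH0 i))))
  simp only [hzero, one_mul] at hl
  exact (tendsto_nhds_unique hl tendsto_const_nhds)

end Mollification

/-! ### Primitives of integrable functions on an interval -/

section Interval

lemma ae_deriv_integral_eq {f : ℝ → ℝ} {a b : ℝ} (hf : IntervalIntegrable f volume a b) :
    ∀ᵐ x, x ∈ uIoc a b → deriv (fun t => ∫ τ in a..t, f τ) x = f x := by
  filter_upwards [hf.ae_hasDerivAt_integral] with x hx hxm
  exact (hx (uIoc_subset_uIcc hxm) a left_mem_uIcc).deriv

/-- Integration by parts for the primitives of two integrable functions. -/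
lemma integral_mul_primitive_add_primitive_mul {f g : ℝ → ℝ} {a b : ℝ}
    (hf : IntervalIntegrable f volume a b) (hg : IntervalIntegrable g volume a b) :
    ∫ x in a..b, (f x * (∫ τ in a..x, g τ) + (∫ τ in a..x, f τ) * g x)
      = (∫ τ in a..b, f τ) * ∫ τ in a..b, g τ := by
  have h := (hf.absolutelyContinuousOnInterval_intervalIntegral
    (c := a) left_mem_uIcc).integral_deriv_mul_eq_sub
    (hg.absolutelyContinuousOnInterval_intervalIntegral (c := a) left_mem_uIcc)
  simp only [intervalIntegral.integral_same, zero_mul, sub_zero] at h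
  rw [← h]
  refine intervalIntegral.integral_congr_ae ?_
  filter_upwards [ae_deriv_integral_eq hf, ae_deriv_integral_eq hg] with x h1 h2 hx
  rw [h1 hx, h2 hx]

lemma continuousOn_primitive_of_intervalIntegrable {f : ℝ → ℝ} {a b : ℝ}
    (hf : IntervalIntegrable f volume a b) :
    ContinuousOn (fun t => ∫ τ in a..t, f τ) (uIcc a b) :=
  (hf.absolutelyContinuousOnInterval_intervalIntegral (c := a) left_mem_uIcc).continuousOn

/-- Adjointness of the backward and the forward primitive: it takes a time integral off a test
function and puts it on the solution. -/
lemma integral_mul_integral_eq_integral_primitive_mul {f g : ℝ → ℝ} {a b : ℝ}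
    (hf : IntervalIntegrable f volume a b) (hg : IntervalIntegrable g volume a b) :
    ∫ x in a..b, f x * (∫ τ in x..b, g τ) = ∫ x in a..b, (∫ τ in a..x, f τ) * g x := by
  have h := integral_mul_primitive_add_primitive_mul hf hg
  have hi1 : IntervalIntegrable (fun x => f x * ∫ τ in a..x, g τ) volume a b :=
    hf.mul_continuousOn (continuousOn_primitive_of_intervalIntegrable hg)
  have hi2 : IntervalIntegrable (fun x => (∫ τ in a..x, f τ) * g x) volume a b :=
    hg.continuousOn_mul (continuousOn_primitive_of_intervalIntegrable hf)
  rw [intervalIntegral.integral_add hi1 hi2] at h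
  have h2 : ∫ x in a..b, f x * (∫ τ in x..b, g τ)
      = ∫ x in a..b, (f x * (∫ τ in a..b, g τ) - f x * ∫ τ in a..x, g τ) := by
    refine intervalIntegral.integral_congr fun x hx => ?_
    have hax : IntervalIntegrable g volume a x := hg.mono_set (uIcc_subset_uIcc_left hx)
    have := intervalIntegral.integral_interval_sub_left hg hax
    rw [← this]
    ring
  rw [h2, intervalIntegral.integral_sub (hf.mul_const _) hi1, intervalIntegral.integral_mul_const]
  linarith

/-- The integrand is half the derivative of a squared primitive; both terms of the energy arise in
this way. -/
lemma integral_mul_primitive_self {f : ℝ → ℝ} {a b : ℝ} (hf : IntervalIntegrable f volume a b) :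
    ∫ x in a..b, f x * (∫ τ in a..x, f τ) = (∫ τ in a..b, f τ) ^ 2 / 2 := by
  have h := integral_mul_primitive_add_primitive_mul hf hf
  have h2 : ∫ x in a..b, (f x * (∫ τ in a..x, f τ) + (∫ τ in a..x, f τ) * f x)
      = 2 * ∫ x in a..b, f x * (∫ τ in a..x, f τ) := by
    rw [← intervalIntegral.integral_const_mul]
    congr 1 with x
    ring
  rw [h2] at h
  linarith [h]

lemma intervalIntegrable_of_memLp_two {f : ℝ → ℝ} (hf : MemLp f 2 volume) (a b : ℝ) :
    IntervalIntegrable f volume a b := by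
  rw [intervalIntegrable_iff]
  have : IsFiniteMeasure (volume.restrict (uIoc a b)) := by unfold uIoc; infer_instance
  exact (hf.restrict _).integrable (by norm_num)

lemma sq_intervalIntegral_le {f : ℝ → ℝ} (hf : MemLp f 2 volume) {T a b : ℝ} (ha : 0 ≤ a)
    (hab : a ≤ b) (hb : b ≤ T) : (∫ τ in a..b, f τ) ^ 2 ≤ T * ∫ τ, f τ ^ 2 := by
  have h := abs_integral_mul_le_sqrt_mul_sqrt (μ := volume.restrict (Ioc a b))
    (memLp_const (1 : ℝ)) (hf.restrict _)
  simp only [one_mul, one_pow, integral_const, MeasurableSet.univ, measureReal_restrict_apply,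
    univ_inter, smul_eq_mul, mul_one, Real.volume_real_Ioc_of_le hab] at h
  rw [intervalIntegral.integral_of_le hab]
  have h2 : ∫ τ in Ioc a b, f τ ^ 2 ≤ ∫ τ, f τ ^ 2 :=
    setIntegral_le_integral hf.integrable_sq (Eventually.of_forall fun _ => sq_nonneg _)
  have h0 : 0 ≤ ∫ τ in Ioc a b, f τ ^ 2 := integral_nonneg fun _ => sq_nonneg _
  calc _ = |∫ τ in Ioc a b, f τ| ^ 2 := (sq_abs _).symm
    _ ≤ (√(b - a) * √(∫ τ in Ioc a b, f τ ^ 2)) ^ 2 := by gcongr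
    _ = (b - a) * ∫ τ in Ioc a b, f τ ^ 2 := by
      rw [mul_pow, Real.sq_sqrt (by linarith), Real.sq_sqrt h0]
    _ ≤ T * ∫ τ, f τ ^ 2 := mul_le_mul (by linarith) h2 h0 (by linarith)

end Interval

/-! ### Square integrable functions on the cylinder and their time primitives -/

namespace WaveProblem

/-- Square integrable functions on space-time that vanish outside `(0,T) × Ω`. -/
structure IsL2Cyl (T : ℝ) (Ω : Set E3) (v : ℝ × E3 → ℝ) : Prop where
  meas : StronglyMeasurable v
  memLp : MemLp v 2 volume
  zero : ∀ z ∉ cyl T Ω, v z = 0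

/-- The primitive in time that vanishes at `t = 0`. -/
noncomputable def timePrimitive (v : ℝ × E3 → ℝ) (z : ℝ × E3) : ℝ := ∫ τ in (0 : ℝ)..z.1, v (τ, z.2)

variable {T : ℝ} {Ω : Set E3}

lemma measurableSet_cyl (T : ℝ) (hΩ : MeasurableSet Ω) : MeasurableSet (cyl T Ω) :=
  measurableSet_Ioo.prod hΩ

lemma stronglyMeasurable_integral_Ioc {v : ℝ × E3 → ℝ} (hv : StronglyMeasurable v)
    {a b : ℝ × E3 → ℝ} (ha : Measurable a) (hb : Measurable b) :
    StronglyMeasurable fun z : ℝ × E3 => ∫ τ in a z..b z, v (τ, z.2) := by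
  have key : ∀ {a b : ℝ × E3 → ℝ}, Measurable a → Measurable b →
      StronglyMeasurable fun z : ℝ × E3 => ∫ τ in Ioc (a z) (b z), v (τ, z.2) := by
    intro a b ha hb
    have h1 : StronglyMeasurable fun q : (ℝ × E3) × ℝ =>
        indicator {q : (ℝ × E3) × ℝ | a q.1 < q.2 ∧ q.2 ≤ b q.1} (fun q => v (q.2, q.1.2)) q := by
      refine StronglyMeasurable.indicator ?_ ?_
      · exact hv.comp_measurable (measurable_snd.prodMk (measurable_snd.comp measurable_fst))
      · exact (measurableSet_lt (ha.comp measurable_fst) measurable_snd).inter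
          (measurableSet_le measurable_snd (hb.comp measurable_fst))
    have h2 := h1.integral_prod_right'
      (ν := (volume : Measure ℝ))
    convert h2 using 2 with z
    rw [← integral_indicator measurableSet_Ioc]
    rfl
  exact (key ha hb).sub (key hb ha)

lemma stronglyMeasurable_timePrimitive {v : ℝ × E3 → ℝ} (hv : StronglyMeasurable v) :
    StronglyMeasurable (timePrimitive v) :=
  stronglyMeasurable_integral_Ioc hv measurable_const measurable_fst

namespace IsL2Cyl

variable {v u : ℝ × E3 → ℝ}

lemma zero_of_notMem_space (hv : IsL2Cyl T Ω v) {x : E3} (hx : x ∉ Ω) (t : ℝ) : v (t, x) = 0 :=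
  hv.zero _ fun h => hx h.2

lemma integrable_mul (hv : IsL2Cyl T Ω v) (hu : IsL2Cyl T Ω u) :
    Integrable (fun z => v z * u z) volume := hv.memLp.integrable_mul hu.memLp

lemma ae_slice (hv : IsL2Cyl T Ω v) :
    ∀ᵐ x : E3, MemLp (fun t => v (t, x)) 2 volume := by
  have h := hv.memLp.integrable_sq
  rw [Measure.volume_eq_prod] at h
  filter_upwards [h.prod_left_ae] with x hx
  refine (memLp_two_iff_integrable_sq ?_).2 hx
  exact (hv.meas.comp_measurable measurable_prodMk_right).aestronglyMeasurable

lemma integrable_slice_sq (hv : IsL2Cyl T Ω v) :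
    Integrable (fun x : E3 => ∫ t, v (t, x) ^ 2) volume := by
  have h := hv.memLp.integrable_sq
  rw [Measure.volume_eq_prod] at h
  exact h.integral_prod_right

lemma indicator {s : Set (ℝ × E3)} (hs : MeasurableSet s) (hv : IsL2Cyl T Ω v) :
    IsL2Cyl T Ω (s.indicator v) where
  meas := hv.meas.indicator hs
  memLp := hv.memLp.indicator hs
  zero z hz := by
    by_cases h : z ∈ s
    · rw [indicator_of_mem h, hv.zero z hz]
    · rw [indicator_of_notMem h]

/-- A function on the cylinder that is controlled by the `L²` norms in time of `v`. -/
lemma indicator_of_sq_le (hv : IsL2Cyl T Ω v) (hΩ : MeasurableSet Ω) {F : ℝ × E3 → ℝ}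
    (hF : StronglyMeasurable F)
    (hle : ∀ᵐ x : E3, ∀ t ∈ Ioo 0 T, F (t, x) ^ 2 ≤ T * ∫ τ, v (τ, x) ^ 2) :
    IsL2Cyl T Ω ((cyl T Ω).indicator F) where
  meas := hF.indicator (measurableSet_cyl T hΩ)
  memLp := by
    have hm := hF.indicator (measurableSet_cyl T hΩ)
    refine (memLp_two_iff_integrable_sq hm.aestronglyMeasurable).2 ?_
    have h1 : Integrable ((Ioo 0 T).indicator fun _ => T) (volume : Measure ℝ) :=
      (integrable_indicator_iff measurableSet_Ioo).2 (integrableOn_const (by simp))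
    have h2 := h1.mul_prod hv.integrable_slice_sq
    rw [← Measure.volume_eq_prod] at h2
    refine h2.mono' (hm.pow 2).aestronglyMeasurable ?_
    have hae : ∀ᵐ z : ℝ × E3, ∀ t ∈ Ioo 0 T, F (t, z.2) ^ 2 ≤ T * ∫ τ, v (τ, z.2) ^ 2 := by
      rw [Measure.volume_eq_prod]
      exact Measure.quasiMeasurePreserving_snd.ae hle
    filter_upwards [hae] with z hz
    by_cases hzc : z ∈ cyl T Ω
    · rw [indicator_of_mem hzc, indicator_of_mem hzc.1, Real.norm_eq_abs, abs_of_nonneg (sq_nonneg _)]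
      exact hz z.1 hzc.1
    · rw [indicator_of_notMem hzc]
      simp only [ne_eq, OfNat.ofNat_ne_zero, not_false_eq_true, zero_pow, norm_zero]
      by_cases hz1 : z.1 ∈ Ioo 0 T
      · rw [indicator_of_mem hz1]
        exact mul_nonneg (hz1.1.le.trans hz1.2.le) (integral_nonneg fun _ => sq_nonneg _)
      · rw [indicator_of_notMem hz1, zero_mul]
  zero z hz := indicator_of_notMem hz _

lemma ae_sq_timePrimitive_le (hv : IsL2Cyl T Ω v) :
    ∀ᵐ x : E3, ∀ t ∈ Icc 0 T, timePrimitive v (t, x) ^ 2 ≤ T * ∫ τ, v (τ, x) ^ 2 := by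
  filter_upwards [hv.ae_slice] with x hx t ht
  exact sq_intervalIntegral_le hx le_rfl ht.1 ht.2

lemma indicator_timePrimitive (hv : IsL2Cyl T Ω v) (hΩ : MeasurableSet Ω) :
    IsL2Cyl T Ω ((cyl T Ω).indicator (timePrimitive v)) := by
  refine hv.indicator_of_sq_le hΩ (stronglyMeasurable_timePrimitive hv.meas) ?_
  filter_upwards [hv.ae_sq_timePrimitive_le] with x hx t ht
  exact hx t (Ioo_subset_Icc_self ht)

lemma integrable_sq_timePrimitive (hv : IsL2Cyl T Ω v) {s : ℝ} (hs : s ∈ Icc 0 T) :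
    Integrable (fun x : E3 => timePrimitive v (s, x) ^ 2) volume := by
  refine (hv.integrable_slice_sq.const_mul T).mono' ?_ ?_
  · exact (((stronglyMeasurable_timePrimitive hv.meas).comp_measurable
      measurable_prodMk_left).pow 2).aestronglyMeasurable
  · filter_upwards [hv.ae_sq_timePrimitive_le] with x hx
    rw [Real.norm_eq_abs, abs_of_nonneg (sq_nonneg _)]
    exact hx s hs

/-- Fubini's theorem, with the integration in time carried out first. -/
lemma integral_mul_eq_integral_intervalIntegral (hv : IsL2Cyl T Ω v) {s : ℝ} (hs : s ∈ Icc 0 T)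
    {F : ℝ × E3 → ℝ} (hi : Integrable (fun z => v z * (cyl s Ω).indicator F z)) :
    ∫ z, v z * (cyl s Ω).indicator F z = ∫ x : E3, ∫ t in (0 : ℝ)..s, v (t, x) * F (t, x) := by
  have h := integral_prod_symm _ (Measure.volume_eq_prod ℝ E3 ▸ hi)
  rw [← Measure.volume_eq_prod] at h
  rw [h]
  congr 1 with x
  rw [intervalIntegral.integral_of_le hs.1, integral_Ioc_eq_integral_Ioo,
    ← integral_indicator measurableSet_Ioo]
  congr 1 with t
  by_cases hx : x ∈ Ω
  · by_cases ht : t ∈ Ioo 0 s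
    · rw [indicator_of_mem (show (t, x) ∈ cyl s Ω from ⟨ht, hx⟩), indicator_of_mem ht]
    · rw [indicator_of_notMem (fun h : (t, x) ∈ cyl s Ω => ht h.1), indicator_of_notMem ht, mul_zero]
  · by_cases ht : t ∈ Ioo 0 s
    · rw [indicator_of_mem ht, hv.zero_of_notMem_space hx, zero_mul, zero_mul]
    · rw [indicator_of_notMem ht, hv.zero_of_notMem_space hx, zero_mul]

/-- Adjointness of the two primitives, applied on almost every line in the time direction. -/
lemma integral_mul_remaining (hT : 0 ≤ T) (hΩ : MeasurableSet Ω) (hv : IsL2Cyl T Ω v)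
    (hu : IsL2Cyl T Ω u) :
    ∫ z, v z * (cyl T Ω).indicator (fun z => ∫ τ in z.1..T, u (τ, z.2)) z
      = ∫ z, u z * (cyl T Ω).indicator (timePrimitive v) z := by
  have hR : IsL2Cyl T Ω ((cyl T Ω).indicator fun z => ∫ τ in z.1..T, u (τ, z.2)) := by
    refine hu.indicator_of_sq_le hΩ
      (stronglyMeasurable_integral_Ioc hu.meas measurable_fst measurable_const) ?_
    filter_upwards [hu.ae_slice] with x hx t ht
    exact sq_intervalIntegral_le hx ht.1.le ht.2.le le_rfl
  have hTm : T ∈ Icc 0 T := ⟨hT, le_rfl⟩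
  rw [hv.integral_mul_eq_integral_intervalIntegral hTm (hv.integrable_mul hR),
    hu.integral_mul_eq_integral_intervalIntegral hTm
      (hu.integrable_mul (hv.indicator_timePrimitive hΩ))]
  refine integral_congr_ae ?_
  filter_upwards [hv.ae_slice, hu.ae_slice] with x h1 h2
  have := integral_mul_integral_eq_integral_primitive_mul (a := 0) (b := T)
    (intervalIntegrable_of_memLp_two h1 _ _)
    (intervalIntegrable_of_memLp_two h2 _ _)
  simp only [timePrimitive, this]
  congr 1 with t
  ring

lemma integral_mul_timePrimitive_self (hΩ : MeasurableSet Ω) (hv : IsL2Cyl T Ω v)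
    {s : ℝ} (hs : s ∈ Icc 0 T) :
    ∫ z, v z * (cyl s Ω).indicator (timePrimitive v) z
      = (∫ x : E3, timePrimitive v (s, x) ^ 2) / 2 := by
  have hi : Integrable (fun z => v z * (cyl s Ω).indicator (timePrimitive v) z) := by
    have h1 := hv.integrable_mul
      ((hv.indicator_timePrimitive hΩ).indicator (measurableSet_cyl s hΩ))
    rwa [indicator_indicator, inter_eq_left.2 (show cyl s Ω ⊆ cyl T Ω from
      prod_mono_left (Ioo_subset_Ioo_right hs.2))] at h1
  rw [hv.integral_mul_eq_integral_intervalIntegral hs hi, ← integral_div]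
  refine integral_congr_ae ?_
  filter_upwards [hv.ae_slice] with x h1
  exact integral_mul_primitive_self (a := 0) (b := s)
    (intervalIntegrable_of_memLp_two h1 _ _)

end IsL2Cyl

end WaveProblem

/-! ### Test functions and their backward time primitives -/

namespace WaveProblem

variable {T : ℝ} {Ω : Set E3} {U V : Set (ℝ × E3)} {φ ψ : ℝ × E3 → ℝ}

namespace IsTest

lemma mono (h : IsTest U φ) (hUV : U ⊆ V) : IsTest V φ := ⟨h.1, h.2.1, h.2.2.trans hUV⟩

lemma differentiable (h : IsTest U φ) : Differentiable ℝ φ := h.1.differentiable (by simp)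

lemma continuous_fderiv_apply (h : IsTest U φ) (v : ℝ × E3) :
    Continuous fun z => fderiv ℝ φ z v :=
  (h.1.continuous_fderiv (by simp)).clm_apply continuous_const

lemma hasCompactSupport_fderiv_apply (h : IsTest U φ) (v : ℝ × E3) :
    HasCompactSupport fun z => fderiv ℝ φ z v :=
  h.2.1.fderiv_apply (𝕜 := ℝ) v

lemma eq_zero (h : IsTest U φ) {z : ℝ × E3} (hz : z ∉ U) : φ z = 0 :=
  image_eq_zero_of_notMem_tsupport fun hm => hz (h.2.2 hm)

lemma fderiv_eq_zero (h : IsTest U φ) {z : ℝ × E3} (hz : z ∉ U) : fderiv ℝ φ z = 0 :=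
  image_eq_zero_of_notMem_tsupport fun hm => hz (h.2.2 (tsupport_fderiv_subset ℝ hm))

lemma fderiv_apply_eq_zero (h : IsTest U φ) {z : ℝ × E3} (hz : z ∉ U) (v : ℝ × E3) :
    fderiv ℝ φ z v = 0 := by
  rw [h.fderiv_eq_zero hz, zero_apply]

end IsTest

lemma isL2Cyl_of_continuous {f : ℝ × E3 → ℝ} (hf : Continuous f) (hs : HasCompactSupport f)
    (h0 : ∀ z ∉ cyl T Ω, f z = 0) : IsL2Cyl T Ω f :=
  ⟨hf.stronglyMeasurable, hf.memLp_of_hasCompactSupport hs, h0⟩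

lemma IsTest.isL2Cyl (h : IsTest (cyl T Ω) φ) : IsL2Cyl T Ω φ :=
  isL2Cyl_of_continuous h.1.continuous h.2.1 fun _ hz => h.eq_zero hz

lemma IsTest.isL2Cyl_dx (h : IsTest (cyl T Ω) φ) (e : E3) : IsL2Cyl T Ω (fun z => dx φ z e) :=
  isL2Cyl_of_continuous (h.continuous_fderiv_apply _) (h.hasCompactSupport_fderiv_apply _)
    fun _ hz => h.fderiv_apply_eq_zero hz _

lemma hasDerivAt_dt (h : Differentiable ℝ φ) (t : ℝ) (x : E3) :
    HasDerivAt (fun s => φ (s, x)) (dt φ (t, x)) t := by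
  have h1 : HasDerivAt (fun s : ℝ => (s, x)) ((1 : ℝ), (0 : E3)) t :=
    (hasDerivAt_id t).prodMk (hasDerivAt_const t x)
  exact (h (t, x)).hasFDerivAt.comp_hasDerivAt t h1

lemma hasDerivAt_dx (h : Differentiable ℝ φ) (t : ℝ) (x e : E3) (s : ℝ) :
    HasDerivAt (fun s : ℝ => φ (t, x + s • e)) (dx φ (t, x + s • e) e) s := by
  have h1 : HasDerivAt (fun s : ℝ => (t, x + s • e)) ((0 : ℝ), e) s := by
    have := ((hasDerivAt_id s).smul_const e).const_add x
    simp only [id, one_smul] at this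
    exact (hasDerivAt_const s t).prodMk this
  exact (h (t, x + s • e)).hasFDerivAt.comp_hasDerivAt s h1

/-- The tail integral is a convolution in time, with `x` as a parameter, of `φ` with the indicator
of the negative half-line; it inherits the smoothness of the compactly supported factor. -/
lemma contDiff_integral_Ioi (hφ : ContDiff ℝ ∞ φ) (hs : HasCompactSupport φ) :
    ContDiff ℝ ∞ fun z : ℝ × E3 => ∫ τ in Ioi z.1, φ (τ, z.2) := by
  have hloc : LocallyIntegrable ((Iio (0 : ℝ)).indicator fun _ => (1 : ℝ)) volume :=
    (locallyIntegrable_const 1).indicator measurableSet_Iio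
  have h := contDiffOn_convolution_right_with_param (μ := (volume : Measure ℝ)) (n := ⊤)
    (ContinuousLinearMap.lsmul ℝ ℝ) (g := fun (x : E3) (t : ℝ) => φ (t, x)) (s := univ)
    isOpen_univ (hs.isCompact.image continuous_fst)
    (fun x t _ ht => image_eq_zero_of_notMem_tsupport fun hm => ht ⟨(t, x), hm, rfl⟩) hloc
    (by
      refine ContDiff.contDiffOn ?_
      exact hφ.comp (contDiff_snd.prodMk contDiff_fst))
  rw [univ_prod_univ, contDiffOn_univ] at h
  have h2 := h.comp (contDiff_snd.prodMk contDiff_fst : ContDiff ℝ ∞ fun z : ℝ × E3 => (z.2, z.1))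
  convert h2 using 1
  ext z
  simp only [Function.comp, convolution_def, ContinuousLinearMap.lsmul_apply, smul_eq_mul]
  rw [← integral_indicator measurableSet_Ioi, ← integral_sub_left_eq_self _ _ z.1]
  congr 1 with t
  by_cases ht : t < 0
  · rw [indicator_of_mem (show z.1 - t ∈ Ioi z.1 by simp only [mem_Ioi]; linarith),
      indicator_of_mem (show t ∈ Iio 0 from ht), one_mul]
  · rw [indicator_of_notMem (show z.1 - t ∉ Ioi z.1 by simp only [mem_Ioi]; linarith),
      indicator_of_notMem (show t ∉ Iio 0 from ht), zero_mul]

lemma integral_Ioi_eq_intervalIntegral {f : ℝ → ℝ} {t : ℝ} (htT : t ≤ T) (h0 : ∀ τ, T < τ → f τ = 0) :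
    ∫ τ in Ioi t, f τ = ∫ τ in t..T, f τ := by
  rw [intervalIntegral.integral_of_le htT]
  refine setIntegral_eq_of_subset_of_forall_sdiff_eq_zero measurableSet_Ioi Ioc_subset_Ioi_self ?_
  intro τ hτ
  exact h0 τ (not_le.1 fun h => hτ.2 ⟨hτ.1, h⟩)

/-- Every test function in `(0,T) × Ω` is the time derivative there of a test function that need not
vanish at `t = 0`. -/
lemma IsTest.exists_primitive (hT : 0 < T) (hψ : IsTest (cyl T Ω) ψ) :
    ∃ Φ, IsTest (Iio T ×ˢ Ω) Φ ∧ ∀ z ∈ cyl T Ω, dt Φ z = ψ z ∧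
      Φ z = -∫ τ in z.1..T, ψ (τ, z.2) ∧
      ∀ e, dx Φ z e = -∫ τ in z.1..T, dx ψ (τ, z.2) e := by
  -- The tail integral need not vanish for early times. The factor is `0` for `t ≤ -1` and `1` for
  -- `t ≥ 0`, so it gives compact support without changing anything in the cylinder.
  set Φ : ℝ × E3 → ℝ := fun z =>
    Real.smoothTransition (z.1 + 1) * -∫ τ in Ioi z.1, ψ (τ, z.2) with hΦ
  have hΦc : ContDiff ℝ ∞ Φ := by
    refine ContDiff.mul ?_ (contDiff_integral_Ioi hψ.1 hψ.2.1).neg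
    exact Real.smoothTransition.contDiff.comp (contDiff_fst.add contDiff_const)
  have hΦd : Differentiable ℝ Φ := hΦc.differentiable (by simp)
  have hval : ∀ t x, 0 < t → t < T → Φ (t, x) = -∫ τ in t..T, ψ (τ, x) := by
    intro t x h0 h1
    simp only [hΦ]
    rw [Real.smoothTransition.one_of_one_le (by linarith), one_mul,
      integral_Ioi_eq_intervalIntegral h1.le]
    intro τ hτ
    exact hψ.eq_zero fun h => absurd h.1.2 (not_lt.2 hτ.le)
  -- The last time in the support of `ψ`: beyond `b < T` the tail integral is zero, so the support
  -- of `Φ` stays away from `T`.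
  obtain ⟨b, hbT, hb⟩ : ∃ b < T, ∀ z ∈ tsupport ψ, z.1 ≤ b := by
    rcases (tsupport ψ).eq_empty_or_nonempty with h | h
    · exact ⟨0, hT, by simp [h]⟩
    · obtain ⟨z, hz, hzm⟩ := hψ.2.1.isCompact.exists_isMaxOn h continuous_fst.continuousOn
      exact ⟨z.1, (hψ.2.2 hz).1.2, fun y hy => hzm hy⟩
  have hsub : Function.support Φ ⊆ Icc (-1) b ×ˢ (Prod.snd '' tsupport ψ) := by
    intro z hz
    have h1 : -1 ≤ z.1 := by
      by_contra h
      exact hz (by simp [hΦ, Real.smoothTransition.zero_of_nonpos (show z.1 + 1 ≤ 0 by linarith)])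
    have h2 : ∃ τ ∈ Ioi z.1, ψ (τ, z.2) ≠ 0 := by
      by_contra! h
      exact hz (by simp only [hΦ]; rw [setIntegral_eq_zero_of_forall_eq_zero h]; simp)
    obtain ⟨τ, hτ, hne⟩ := h2
    have hm := subset_tsupport _ hne
    exact ⟨⟨h1, hτ.le.trans (hb _ hm)⟩, ⟨_, hm, rfl⟩⟩
  have hK : IsCompact (Icc (-1) b ×ˢ (Prod.snd '' tsupport ψ)) :=
    isCompact_Icc.prod (hψ.2.1.isCompact.image continuous_snd)
  refine ⟨Φ, ⟨hΦc, HasCompactSupport.of_support_subset_isCompact hK hsub, ?_⟩, ?_⟩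
  · refine (closure_minimal hsub hK.isClosed).trans (prod_mono ?_ ?_)
    · exact fun t ht => lt_of_le_of_lt ht.2 hbT
    · rintro _ ⟨z, hz, rfl⟩
      exact (hψ.2.2 hz).2
  rintro ⟨t, x⟩ ⟨ht, hx⟩
  have ht : 0 < t ∧ t < T := ht
  have hcont : ∀ y, Continuous fun τ => ψ (τ, y) := fun y =>
    hψ.1.continuous.comp (by fun_prop)
  refine ⟨?_, hval t x ht.1 ht.2, fun e => ?_⟩
  · have h1 := hasDerivAt_dt hΦd t x
    have h2 : HasDerivAt (fun s => -∫ τ in s..T, ψ (τ, x)) (ψ (t, x)) t := by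
      have := (intervalIntegral.integral_hasDerivAt_left (a := t) (b := T)
        ((hcont x).intervalIntegrable _ _)
        ((hcont x).stronglyMeasurableAtFilter _ _) (hcont x).continuousAt).neg
      rw [neg_neg] at this
      exact this
    refine h1.unique (h2.congr_of_eventuallyEq ?_)
    filter_upwards [Ioo_mem_nhds ht.1 ht.2] with s hs
    exact hval s x hs.1 hs.2
  · have h1 := hasDerivAt_dx hΦd t x e 0
    simp only [zero_smul, add_zero, hval t _ ht.1 ht.2] at h1
    have hc := hψ.continuous_fderiv_apply ((0 : ℝ), e)
    obtain ⟨M, hM⟩ := (hψ.hasCompactSupport_fderiv_apply ((0 : ℝ), e)).exists_bound_of_continuous hc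
    have h2 := (intervalIntegral.hasDerivAt_integral_of_dominated_loc_of_deriv_le
      (μ := volume) (a := t) (b := T) (F := fun (s : ℝ) τ => ψ (τ, x + s • e))
      (F' := fun (s : ℝ) τ => dx ψ (τ, x + s • e) e) (x₀ := 0) (s := univ) (bound := fun _ => M)
      univ_mem (Eventually.of_forall fun s => (hcont _).aestronglyMeasurable)
      ((hcont _).intervalIntegrable _ _)
      (by
        refine Continuous.aestronglyMeasurable ?_
        exact hc.comp (by fun_prop : Continuous fun τ : ℝ => (τ, x + (0 : ℝ) • e)))
      (Eventually.of_forall fun τ _ s _ => hM _)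
      (by simp)
      (Eventually.of_forall fun τ _ s _ => hasDerivAt_dx hψ.differentiable τ x e s)).2
    simp only [zero_smul, add_zero] at h2
    exact h1.unique h2.neg

end WaveProblem

/-! ### Uniqueness by the energy of the time primitive -/

namespace WaveProblem

variable {T : ℝ} {Ω : Set E3}

lemma integral_congr_of_forall_mem {s : Set (ℝ × E3)} {f g : ℝ × E3 → ℝ}
    (hfg : ∀ z ∈ s, f z = g z) (hf : ∀ z ∉ s, f z = 0) (hg : ∀ z ∉ s, g z = 0) :
    ∫ z, f z = ∫ z, g z := by
  congr 1 with z
  by_cases hz : z ∈ s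
  · exact hfg z hz
  · rw [hf z hz, hg z hz]

lemma IsL2Cyl.ae_eq_of_forall_test {v u : ℝ × E3 → ℝ} (hv : IsL2Cyl T Ω v) (hΩo : IsOpen Ω)
    (hu : IsL2Cyl T Ω u) (h : ∀ ψ, IsTest (cyl T Ω) ψ → ∫ z, v z * ψ z = ∫ z, u z * ψ z) :
    v =ᵐ[volume] u := by
  have hi : LocallyIntegrable (fun z => v z - u z) volume :=
    (hv.memLp.sub hu.memLp).locallyIntegrable (by norm_num)
  have h0 := (isOpen_Ioo.prod hΩo : IsOpen (cyl T Ω)).ae_eq_zero_of_integral_contDiff_smul_eq_zero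
    (hi.locallyIntegrableOn _) (by
      intro ψ h1 h2 h3
      have hψ : IsTest (cyl T Ω) ψ := ⟨h1, h2, h3⟩
      have e := integral_sub (hv.integrable_mul hψ.isL2Cyl) (hu.integrable_mul hψ.isL2Cyl)
      rw [h ψ hψ, sub_self] at e
      rw [← e]
      congr 1 with z
      rw [smul_eq_mul]
      ring)
  filter_upwards [h0] with z hz
  by_cases hzc : z ∈ cyl T Ω
  · exact sub_eq_zero.1 (hz hzc)
  · rw [hv.zero z hzc, hu.zero z hzc]

lemma dx_time_mul {θ : ℝ → ℝ} (hθ : ContDiff ℝ ∞ θ) {ψ : ℝ × E3 → ℝ} (hψ : ContDiff ℝ ∞ ψ)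
    (z : ℝ × E3) (e : E3) : dx (fun z => θ z.1 * ψ z) z e = θ z.1 * dx ψ z e := by
  obtain ⟨t, x⟩ := z
  have hd : ContDiff ℝ ∞ fun z : ℝ × E3 => θ z.1 * ψ z := (hθ.comp contDiff_fst).mul hψ
  have h1 := hasDerivAt_dx (hd.differentiable (by simp)) t x e 0
  have h2 := (hasDerivAt_dx (hψ.differentiable (by simp)) t x e 0).const_mul (θ t)
  simp only [zero_smul, add_zero] at h1 h2
  exact h1.unique h2

/-- The weak gradient of a function with vanishing lateral trace, cut off at time `s` and extended
by zero. -/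
lemma integral_indicator_mul_dx {w G : ℝ × E3 → ℝ} (hw : IsL2Cyl T Ω w) (hG : IsL2Cyl T Ω G)
    (e : E3)
    (h : ∀ φ, IsTest (Ioo 0 T ×ˢ univ) φ → ∫ z, w z * dx φ z e = -∫ z, G z * φ z)
    {s : ℝ} (hs : s ≤ T) {ψ : ℝ × E3 → ℝ} (hψ : ContDiff ℝ ∞ ψ) (hψs : HasCompactSupport ψ) :
    ∫ z, (cyl s Ω).indicator w z * dx ψ z e = -∫ z, (cyl s Ω).indicator G z * ψ z := by
  have hψt : IsTest univ ψ := ⟨hψ, hψs, subset_univ _⟩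
  have m1 : MemLp (fun z => dx ψ z e) 2 volume :=
    (hψt.continuous_fderiv_apply _).memLp_of_hasCompactSupport (hψt.hasCompactSupport_fderiv_apply _)
  have m2 : MemLp ψ 2 volume := hψ.continuous.memLp_of_hasCompactSupport hψs
  set K : ℝ × E3 → ℝ := fun z => w z * dx ψ z e + G z * ψ z with hK
  have hKi : Integrable K volume := (hw.memLp.integrable_mul m1).add (hG.memLp.integrable_mul m2)
  have hKi' : Integrable K ((volume : Measure ℝ).prod (volume : Measure E3)) := by
    rwa [← Measure.volume_eq_prod]
  set F : ℝ → ℝ := fun t => ∫ x, K (t, x) with hF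
  have hFi : Integrable F volume := hKi'.integral_prod_left
  -- Test functions `θ(t) ψ` localize the identity to almost every time slice, since `∂ₑ` does not
  -- act on `θ`. It can then be integrated over `(0,s)` with a sharp cutoff.
  have hF0 : ∀ᵐ t ∂(volume : Measure ℝ), t ∈ Ioo 0 T → F t = 0 := by
    refine isOpen_Ioo.ae_eq_zero_of_integral_contDiff_smul_eq_zero
      (hFi.locallyIntegrable.locallyIntegrableOn _) ?_
    intro θ hθ hθs hθT
    set φ : ℝ × E3 → ℝ := fun z => θ z.1 * ψ z with hφ
    have hsub : tsupport φ ⊆ Prod.fst ⁻¹' tsupport θ := by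
      refine closure_minimal ?_ ((isClosed_tsupport θ).preimage continuous_fst)
      intro z hz
      exact subset_tsupport _ (left_ne_zero_of_mul hz)
    have hφt : IsTest (Ioo 0 T ×ˢ univ) φ :=
      ⟨(hθ.comp contDiff_fst).mul hψ, hψs.mul_left, fun z hz => ⟨hθT (hsub hz), mem_univ _⟩⟩
    have h1 := h φ hφt
    have n1 : MemLp (fun z => dx φ z e) 2 volume :=
      (hφt.continuous_fderiv_apply _).memLp_of_hasCompactSupport
        (hφt.hasCompactSupport_fderiv_apply _)
    have n2 : MemLp φ 2 volume := hφt.1.continuous.memLp_of_hasCompactSupport hφt.2.1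
    have h2 : ∫ z, θ z.1 * K z = 0 := by
      have : ∫ z, (w z * dx φ z e + G z * φ z) = 0 := by
        have := integral_add (hw.memLp.integrable_mul n1) (hG.memLp.integrable_mul n2)
        exact this.trans (eq_neg_iff_add_eq_zero.1 h1)
      rw [← this]
      congr 1 with z
      rw [hφ, dx_time_mul hθ hψ]
      ring
    have hi : Integrable (fun z : ℝ × E3 => θ z.1 * K z) volume := by
      obtain ⟨M, hM⟩ := hθs.exists_bound_of_continuous hθ.continuous
      exact hKi.bdd_mul (c := M) (hθ.continuous.comp continuous_fst).aestronglyMeasurable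
        (Eventually.of_forall fun z => hM z.1)
    rw [Measure.volume_eq_prod] at h2 hi
    rw [integral_prod _ hi] at h2
    rw [← h2]
    congr 1 with t
    simp only [hF, smul_eq_mul]
    rw [← integral_const_mul]
  have hcut : ∀ z, (cyl s Ω).indicator w z * dx ψ z e + (cyl s Ω).indicator G z * ψ z
      = (Ioo 0 s).indicator (fun _ => K z) z.1 := by
    intro z
    by_cases hz : z.1 ∈ Ioo 0 s
    · rw [indicator_of_mem hz]
      by_cases hx : z.2 ∈ Ω
      · have : z ∈ cyl s Ω := ⟨hz, hx⟩
        rw [indicator_of_mem this, indicator_of_mem this]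
      · have : z ∉ cyl s Ω := fun h => hx h.2
        rw [indicator_of_notMem this, indicator_of_notMem this, hK]
        simp only [hw.zero z fun h => hx h.2, hG.zero z fun h => hx h.2]
    · have : z ∉ cyl s Ω := fun h => hz h.1
      rw [indicator_of_notMem hz, indicator_of_notMem this, indicator_of_notMem this]
      ring
  have hset : MeasurableSet ((Ioo 0 s) ×ˢ (univ : Set E3)) := measurableSet_Ioo.prod .univ
  have heqi : (fun z : ℝ × E3 => (Ioo 0 s).indicator (fun _ => K z) z.1)
      = ((Ioo 0 s) ×ˢ (univ : Set E3)).indicator K := by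
    ext z
    by_cases hz : z.1 ∈ Ioo 0 s
    · rw [indicator_of_mem hz, indicator_of_mem (mem_prod.2 ⟨hz, mem_univ _⟩)]
    · rw [indicator_of_notMem hz, indicator_of_notMem fun h => hz h.1]
  have hzero : ∫ z : ℝ × E3, (Ioo 0 s).indicator (fun _ => K z) z.1 = 0 := by
    have hi : Integrable (fun z : ℝ × E3 => (Ioo 0 s).indicator (fun _ => K z) z.1)
        ((volume : Measure ℝ).prod (volume : Measure E3)) := by
      rw [heqi]
      exact hKi'.indicator hset
    rw [Measure.volume_eq_prod, integral_prod _ hi]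
    refine integral_eq_zero_of_ae ?_
    filter_upwards [hF0] with t ht
    by_cases hts : t ∈ Ioo 0 s
    · simp only [indicator_of_mem hts]
      exact ht ⟨hts.1, hts.2.trans_le hs⟩
    · simp [indicator_of_notMem hts]
  rw [eq_neg_iff_add_eq_zero, ← hzero]
  simp only [← hcut]
  have hind : ∀ {v : ℝ × E3 → ℝ}, IsL2Cyl T Ω v → MemLp ((cyl s Ω).indicator v) 2 volume := by
    intro v hv
    have : (cyl s Ω).indicator v = ((Ioo 0 s) ×ˢ (univ : Set E3)).indicator v := by
      ext z
      by_cases hz : z ∈ cyl s Ω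
      · rw [indicator_of_mem hz, indicator_of_mem (mem_prod.2 ⟨hz.1, mem_univ _⟩)]
      · rw [indicator_of_notMem hz]
        by_cases hz2 : z.1 ∈ Ioo 0 s
        · rw [indicator_of_mem (mem_prod.2 ⟨hz2, mem_univ _⟩), hv.zero z fun h => hz ⟨hz2, h.2⟩]
        · rw [indicator_of_notMem fun h => hz2 h.1]
    rw [this]
    exact hv.memLp.indicator hset
  exact (integral_add ((hind hw).integrable_mul m1) ((hind hG).integrable_mul m2)).symm

/-- Uniqueness for the weak wave equation with zero initial and lateral boundary values: the energy
of the time primitive of the solution vanishes. -/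
theorem ae_eq_zero_of_weak_wave (hT : 0 < T) (hΩo : IsOpen Ω) (hΩc : Convex ℝ Ω)
    (hΩb : Bornology.IsBounded Ω) (hΩn : Ω.Nonempty) {ι : Type*} [Fintype ι] (e : ι → E3)
    {w g : ℝ × E3 → ℝ} {G : ι → ℝ × E3 → ℝ}
    (hw : IsL2Cyl T Ω w) (hg : IsL2Cyl T Ω g) (hG : ∀ i, IsL2Cyl T Ω (G i))
    (hwg : ∀ φ, IsTest (Iio T ×ˢ Ω) φ → ∫ z, w z * dt φ z = -∫ z, g z * φ z)
    (hwave : ∀ φ, IsTest (Iio T ×ˢ Ω) φ → ∫ z, g z * dt φ z = ∑ i, ∫ z, G i z * dx φ z (e i))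
    (htrace : ∀ φ, IsTest (Ioo 0 T ×ˢ univ) φ → ∀ i,
      ∫ z, w z * dx φ z (e i) = -∫ z, G i z * φ z) :
    w =ᵐ[volume] 0 := by
  have hΩm := hΩo.measurableSet
  have hcylo : ∀ s, IsOpen (cyl s Ω) := fun s => isOpen_Ioo.prod hΩo
  -- Pairing `v` with the negative backward primitive of `u` equals, up to sign, pairing `u` with
  -- the forward primitive of `v`.
  have hrem : ∀ {v u : ℝ × E3 → ℝ}, IsL2Cyl T Ω v → IsL2Cyl T Ω u → ∀ {F : ℝ × E3 → ℝ},
      (∀ z ∈ cyl T Ω, F z = -∫ τ in z.1..T, u (τ, z.2)) →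
      ∫ z, v z * F z = -∫ z, u z * (cyl T Ω).indicator (timePrimitive v) z := by
    intro v u hv hu F hF
    rw [← hv.integral_mul_remaining hT.le hΩm hu, ← integral_neg]
    refine integral_congr_of_forall_mem (s := cyl T Ω) (fun z hz => ?_) (fun z hz => ?_)
      (fun z hz => ?_)
    · rw [hF z hz, indicator_of_mem hz]; ring
    · rw [hv.zero z hz, zero_mul]
    · rw [hv.zero z hz, zero_mul, neg_zero]
  have hPg := hg.indicator_timePrimitive hΩm
  have hPG := fun i => (hG i).indicator_timePrimitive hΩm
  -- `w` is the time primitive of `g`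
  have hwP : w =ᵐ[volume] (cyl T Ω).indicator (timePrimitive g) := by
    refine hw.ae_eq_of_forall_test hΩo hPg fun ψ hψ => ?_
    obtain ⟨Φ, hΦ, hΦz⟩ := hψ.exists_primitive hT
    have e1 : ∫ z, w z * ψ z = ∫ z, w z * dt Φ z :=
      integral_congr_of_forall_mem (s := cyl T Ω) (fun z hz => by rw [(hΦz z hz).1])
        (fun z hz => by rw [hw.zero z hz, zero_mul]) (fun z hz => by rw [hw.zero z hz, zero_mul])
    have e2 := hrem hg hψ.isL2Cyl (F := Φ) fun z hz => (hΦz z hz).2.1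
    rw [hwg Φ hΦ, e2, neg_neg] at e1
    rw [e1]
    congr 1 with z
    ring
  -- the wave equation, integrated in time
  have hweak : ∀ ψ, IsTest (cyl T Ω) ψ → (∫ z, g z * ψ z)
      + ∑ i, ∫ z, (cyl T Ω).indicator (timePrimitive (G i)) z * dx ψ z (e i) = 0 := by
    intro ψ hψ
    obtain ⟨Φ, hΦ, hΦz⟩ := hψ.exists_primitive hT
    have e1 : ∫ z, g z * ψ z = ∫ z, g z * dt Φ z :=
      integral_congr_of_forall_mem (s := cyl T Ω) (fun z hz => by rw [(hΦz z hz).1])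
        (fun z hz => by rw [hg.zero z hz, zero_mul]) (fun z hz => by rw [hg.zero z hz, zero_mul])
    rw [e1, hwave Φ hΦ, ← Finset.sum_add_distrib]
    refine Finset.sum_eq_zero fun i _ => ?_
    rw [hrem (hG i) (hψ.isL2Cyl_dx (e i)) (F := fun z => dx Φ z (e i))
      fun z hz => (hΦz z hz).2.2 (e i), neg_add_eq_zero]
    congr 1 with z
    ring
  -- The energy identity at time `s`: the integrated equation is tested with `w` cut off at `s`.
  -- Each term is half the integral of a square, and their sum is zero.
  have hslice : ∀ s ∈ Ioo 0 T, ∫ x : E3, timePrimitive g (s, x) ^ 2 = 0 := by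
    intro s hs
    have hsI : s ∈ Icc 0 T := Ioo_subset_Icc_self hs
    have hsub : cyl s Ω ⊆ cyl T Ω := prod_mono_left (Ioo_subset_Ioo_right hs.2.le)
    have hcm := measurableSet_cyl s hΩm
    have : (volume : Measure (ℝ × E3)).IsAddHaarMeasure := by
      rw [Measure.volume_eq_prod]; infer_instance
    -- Only the spatial directions `(0, e i)` enter, so the jump of the cut off `w` at time `s` does
    -- no harm.
    have h := integral_add_sum_eq_zero_of_forall_test (μ := (volume : Measure (ℝ × E3)))
      (C := cyl s Ω) (hcylo s) ((convex_Ioo 0 s).prod hΩc) ((Metric.isBounded_Ioo 0 s).prod hΩb)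
      ((nonempty_Ioo.2 hs.1).prod hΩn) (fun i => ((0 : ℝ), e i))
      hg.meas hg.memLp (fun i => (hPG i).meas) (fun i => (hPG i).memLp)
      (hw.indicator hcm).meas (hw.indicator hcm).memLp (fun z hz => indicator_of_notMem hz _)
      (fun i => ((hG i).indicator hcm).meas) (fun i => ((hG i).indicator hcm).memLp)
      (fun i z hz => indicator_of_notMem hz _)
      (fun i ψ h1 h2 => integral_indicator_mul_dx hw (hG i) (e i) (fun φ hφ => htrace φ hφ i)
        hs.2.le h1 h2)
      (fun ψ h1 h2 h3 => hweak ψ ⟨h1, h2, h3.trans hsub⟩)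
    have t1 : ∫ z, g z * (cyl s Ω).indicator w z = (∫ x : E3, timePrimitive g (s, x) ^ 2) / 2 := by
      rw [← hg.integral_mul_timePrimitive_self hΩm hsI]
      refine integral_congr_ae ?_
      filter_upwards [hwP] with z hz
      by_cases hzs : z ∈ cyl s Ω
      · rw [indicator_of_mem hzs, indicator_of_mem hzs, hz, indicator_of_mem (hsub hzs)]
      · rw [indicator_of_notMem hzs, indicator_of_notMem hzs]
    have t2 : ∀ i, ∫ z, (cyl T Ω).indicator (timePrimitive (G i)) z * (cyl s Ω).indicator (G i) z
        = (∫ x : E3, timePrimitive (G i) (s, x) ^ 2) / 2 := by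
      intro i
      rw [← (hG i).integral_mul_timePrimitive_self hΩm hsI]
      congr 1 with z
      by_cases hzs : z ∈ cyl s Ω
      · rw [indicator_of_mem hzs, indicator_of_mem hzs, indicator_of_mem (hsub hzs), mul_comm]
      · rw [indicator_of_notMem hzs, indicator_of_notMem hzs, mul_zero, mul_zero]
    simp only [t1, t2] at h
    have n1 : 0 ≤ ∫ x : E3, timePrimitive g (s, x) ^ 2 := integral_nonneg fun _ => sq_nonneg _
    have n2 : 0 ≤ ∑ i, (∫ x : E3, timePrimitive (G i) (s, x) ^ 2) / 2 :=
      Finset.sum_nonneg fun i _ => div_nonneg (integral_nonneg fun _ => sq_nonneg _) (by norm_num)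
    linarith
  have hsq := hPg.memLp.integrable_sq
  have hint : ∫ z, (cyl T Ω).indicator (timePrimitive g) z ^ 2 = 0 := by
    rw [Measure.volume_eq_prod] at hsq ⊢
    rw [integral_prod _ hsq]
    refine integral_eq_zero_of_ae (Eventually.of_forall fun t => ?_)
    by_cases ht : t ∈ Ioo 0 T
    · have hle : ∫ x : E3, (cyl T Ω).indicator (timePrimitive g) (t, x) ^ 2
          ≤ ∫ x : E3, timePrimitive g (t, x) ^ 2 := by
        refine integral_mono_of_nonneg (Eventually.of_forall fun _ => sq_nonneg _)
          (hg.integrable_sq_timePrimitive (Ioo_subset_Icc_self ht)) (Eventually.of_forall fun x => ?_)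
        by_cases hx : (t, x) ∈ cyl T Ω
        · simp only [indicator_of_mem hx, le_refl]
        · simp only [indicator_of_notMem hx]
          exact (zero_pow two_ne_zero).trans_le (sq_nonneg _)
      rw [hslice t ht] at hle
      exact le_antisymm hle (integral_nonneg fun _ => sq_nonneg _)
    · have : ∀ x : E3, (t, x) ∉ cyl T Ω := fun x h => ht h.1
      simp [indicator_of_notMem (this _)]
  have hzero := (integral_eq_zero_iff_of_nonneg (fun z => sq_nonneg _) hPg.memLp.integrable_sq).1 hint
  filter_upwards [hwP, hzero] with z h1 h2
  rw [h1]
  exact pow_eq_zero_iff (two_ne_zero) |>.1 h2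

end WaveProblem

/-! ### Cutoff near the sphere and the dependence of Green's functional on boundary values -/

lemma Real.exists_abs_deriv_smoothTransition_le :
    ∃ M : ℝ, ∀ y, |deriv Real.smoothTransition y| ≤ M := by
  have hc : Continuous (deriv Real.smoothTransition) :=
    (Real.smoothTransition.contDiff (n := 1)).continuous_deriv_one
  have hs : HasCompactSupport (deriv Real.smoothTransition) := by
    refine HasCompactSupport.intro (isCompact_Icc (a := 0) (b := 1)) fun y hy => ?_
    rw [mem_Icc, not_and_or, not_le, not_le] at hy
    rcases hy with hy | hy
    · have : Real.smoothTransition =ᶠ[𝓝 y] fun _ => 0 := by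
        filter_upwards [Iio_mem_nhds hy] with t ht
        exact Real.smoothTransition.zero_of_nonpos (le_of_lt ht)
      rw [this.deriv_eq, deriv_const]
    · have : Real.smoothTransition =ᶠ[𝓝 y] fun _ => 1 := by
        filter_upwards [Ioi_mem_nhds hy] with t ht
        exact Real.smoothTransition.one_of_one_le (le_of_lt ht)
      rw [this.deriv_eq, deriv_const]
  obtain ⟨M, hM⟩ := hs.exists_bound_of_continuous hc
  exact ⟨M, hM⟩

lemma Real.deriv_smoothTransition_of_one_lt {y : ℝ} (hy : 1 < y) :
    deriv Real.smoothTransition y = 0 := by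
  have : Real.smoothTransition =ᶠ[𝓝 y] fun _ => 1 := by
    filter_upwards [Ioi_mem_nhds hy] with t ht
    exact Real.smoothTransition.one_of_one_le (le_of_lt ht)
  rw [this.deriv_eq, deriv_const]

/-- The point is the radial projection, in an arbitrary direction at the centre. It lets a Lipschitz
function that vanishes on the sphere be bounded by the distance `r - ‖x - p‖`. -/
lemma exists_mem_sphere_dist_eq {E : Type*} [NormedAddCommGroup E] [NormedSpace ℝ E] [Nontrivial E]
    {p x : E} {r : ℝ} (hr : 0 ≤ r) (hx : ‖x - p‖ ≤ r) :
    ∃ q ∈ Metric.sphere p r, dist x q = r - ‖x - p‖ := by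
  rcases eq_or_ne x p with rfl | hne
  · obtain ⟨y, hy⟩ := exists_norm_eq E hr
    exact ⟨x + y, by simp [hy], by simp [hy]⟩
  · have h0 : ‖x - p‖ ≠ 0 := norm_ne_zero_iff.2 (sub_ne_zero.2 hne)
    refine ⟨p + (r / ‖x - p‖) • (x - p), ?_, ?_⟩
    · rw [mem_sphere_iff_norm, add_sub_cancel_left, norm_smul, norm_div, norm_norm,
        div_mul_cancel₀ _ h0, Real.norm_of_nonneg hr]
    · have : x - (p + (r / ‖x - p‖) • (x - p)) = (1 - r / ‖x - p‖) • (x - p) := by module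
      rw [dist_eq_norm, this, norm_smul, ← norm_norm (x - p), ← norm_mul, norm_norm, sub_mul,
        div_mul_cancel₀ _ h0, one_mul, norm_sub_rev, Real.norm_of_nonneg (by linarith)]

namespace WaveProblem

variable {T r : ℝ} {p : E3}

/-- A smooth cutoff function in the ball `B(p,r)`, equal to `1` off a layer at the sphere whose
width is of order `1/n`. -/
noncomputable def ballCutoff (p : E3) (r : ℝ) (n : ℕ) (x : E3) : ℝ :=
  -- The shift by `1` makes the cutoff vanish where `n (r² - ‖x - p‖²) ≤ 1`, a neighbourhood of the
  -- sphere when `n > 0`; the squared norm keeps it smooth at `p`.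
  Real.smoothTransition (n * (r ^ 2 - ‖x - p‖ ^ 2) - 1)

lemma contDiff_ballCutoff (p : E3) (r : ℝ) (n : ℕ) : ContDiff ℝ ∞ (ballCutoff p r n) := by
  refine Real.smoothTransition.contDiff.comp ?_
  have : ContDiff ℝ ∞ fun x : E3 => ‖x - p‖ ^ 2 := (contDiff_id.sub contDiff_const).norm_sq ℝ
  fun_prop

lemma fderiv_ballCutoff_mul {ψ : ℝ × E3 → ℝ} (hψ : Differentiable ℝ ψ) (n : ℕ) (z v : ℝ × E3) :
    fderiv ℝ (fun z => ballCutoff p r n z.2 * ψ z) z v = ballCutoff p r n z.2 * fderiv ℝ ψ z v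
      + ψ z * (deriv Real.smoothTransition (n * (r ^ 2 - ‖z.2 - p‖ ^ 2) - 1)
        * (n * (-(2 * ⟪z.2 - p, v.2⟫)))) := by
  have h1 : HasFDerivAt (fun z : ℝ × E3 => z.2 - p) (ContinuousLinearMap.snd ℝ ℝ E3) z :=
    hasFDerivAt_snd.sub_const p
  have h2 := (((h1.norm_sq.const_sub (r ^ 2)).const_mul (n : ℝ)).sub_const 1)
  have h3 : HasDerivAt Real.smoothTransition
      (deriv Real.smoothTransition (n * (r ^ 2 - ‖z.2 - p‖ ^ 2) - 1))
      (n * (r ^ 2 - ‖z.2 - p‖ ^ 2) - 1) :=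
    ((Real.smoothTransition.contDiff (n := 1)).differentiable (by simp) _).hasDerivAt
  have h4 := (h3.comp_hasFDerivAt z h2).mul (hψ z).hasFDerivAt
  have h5 : fderiv ℝ (fun z => ballCutoff p r n z.2 * ψ z) z = _ := h4.fderiv
  rw [h5]
  simp [ballCutoff, inner_sub_left]

lemma isTest_ballCutoff_mul {ψ : ℝ × E3 → ℝ} (hψ : IsTest (Ioo 0 T ×ˢ univ) ψ) (hr : 0 ≤ r)
    (n : ℕ) : IsTest (cyl T (Metric.ball p r)) fun z => ballCutoff p r n z.2 * ψ z := by
  refine ⟨((contDiff_ballCutoff p r n).comp contDiff_snd).mul hψ.1, hψ.2.1.mul_left, ?_⟩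
  have hcl : IsClosed {z : ℝ × E3 | 1 ≤ n * (r ^ 2 - ‖z.2 - p‖ ^ 2)} :=
    isClosed_le (by fun_prop) (by fun_prop)
  have hsub : tsupport (fun z => ballCutoff p r n z.2 * ψ z)
      ⊆ tsupport ψ ∩ {z : ℝ × E3 | 1 ≤ n * (r ^ 2 - ‖z.2 - p‖ ^ 2)} := by
    refine closure_minimal (fun z hz => ⟨subset_tsupport _ (right_ne_zero_of_mul hz), ?_⟩)
      ((isClosed_tsupport ψ).inter hcl)
    have h1 : ballCutoff p r n z.2 ≠ 0 := left_ne_zero_of_mul hz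
    by_contra h
    exact h1 (Real.smoothTransition.zero_of_nonpos (by
      simp only [mem_ofPred_eq, not_le] at h
      linarith))
  intro z hz
  obtain ⟨h1, h2⟩ := hsub hz
  refine ⟨(hψ.2.2 h1).1, ?_⟩
  rw [mem_ball_iff_norm]
  by_contra h
  have h3 : r ^ 2 ≤ ‖z.2 - p‖ ^ 2 := by
    have := not_lt.1 h
    gcongr
  have h4 : (n : ℝ) * (r ^ 2 - ‖z.2 - p‖ ^ 2) ≤ 0 :=
    mul_nonpos_of_nonneg_of_nonpos (Nat.cast_nonneg n) (by linarith)
  have h5 : 1 ≤ (n : ℝ) * (r ^ 2 - ‖z.2 - p‖ ^ 2) := h2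
  linarith

lemma eventually_ballCutoff_argument {x : E3} (hx : x ∈ Metric.ball p r) :
    ∀ᶠ n : ℕ in atTop, 1 < n * (r ^ 2 - ‖x - p‖ ^ 2) - 1 := by
  have h0 : 0 < r ^ 2 - ‖x - p‖ ^ 2 := by
    rw [mem_ball_iff_norm] at hx
    have := pow_lt_pow_left₀ hx (norm_nonneg _) two_ne_zero
    linarith
  have := (tendsto_natCast_atTop_atTop (R := ℝ)).atTop_mul_const h0
  filter_upwards [this.eventually_gt_atTop 2] with n hn
  linarith

/-- The derivative of the cutoff is of order `n`, but it lives in a layer of width of order `1/n`,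
where `ψ` is itself of order `1/n` because it is Lipschitz and vanishes on the sphere. -/
lemma exists_abs_fderiv_ballCutoff_mul_le {ψ : ℝ × E3 → ℝ} (hψ : IsTest (Ioo 0 T ×ˢ univ) ψ)
    (hr : 0 < r) (h0 : ∀ z ∈ Ioo 0 T ×ˢ Metric.sphere p r, ψ z = 0) :
    ∃ C : ℝ, ∀ n, ∀ z ∈ cyl T (Metric.ball p r), ∀ v,
      |fderiv ℝ (fun z => ballCutoff p r n z.2 * ψ z) z v| ≤ C * ‖v‖ := by
  obtain ⟨L, hL⟩ := ContDiff.lipschitzWith_of_hasCompactSupport hψ.2.1 hψ.1 (by simp)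
  obtain ⟨M, hM⟩ := Real.exists_abs_deriv_smoothTransition_le
  obtain ⟨A, hA⟩ := (hψ.2.1.fderiv (𝕜 := ℝ)).exists_bound_of_continuous
    (hψ.1.continuous_fderiv (by simp))
  have hM0 : 0 ≤ M := (abs_nonneg _).trans (hM 0)
  -- `A` bounds the term where `ψ` is differentiated. In the other term, `|ψ| ≤ L (r - ρ)` and `n (r
  -- - ρ) r ≤ 2` in the layer turn `2 L M n (r - ρ) r` into `4 L M`.
  refine ⟨A + 4 * L * M, fun n z hz v => ?_⟩
  obtain ⟨ht, hx⟩ := hz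
  rw [mem_ball_iff_norm] at hx
  set ρ := ‖z.2 - p‖ with hρ
  have hρ0 : 0 ≤ ρ := norm_nonneg _
  have hψle : |ψ z| ≤ L * (r - ρ) := by
    obtain ⟨q, hq, hd⟩ := exists_mem_sphere_dist_eq hr.le hx.le
    have h1 := hL.dist_le_mul z (z.1, q)
    rw [h0 (z.1, q) ⟨ht, hq⟩, Real.dist_eq, sub_zero] at h1
    have h2 : dist z (z.1, q) = r - ρ := by
      rw [Prod.dist_eq]
      simp only [dist_self, hd]
      exact max_eq_right (by linarith)
    rwa [h2] at h1
  rw [fderiv_ballCutoff_mul hψ.differentiable]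
  have hv2 : ‖v.2‖ ≤ ‖v‖ := norm_snd_le v
  have hin : |⟪z.2 - p, v.2⟫| ≤ r * ‖v‖ :=
    (abs_real_inner_le_norm _ _).trans (mul_le_mul hx.le hv2 (norm_nonneg _) hr.le)
  have b1 : |ballCutoff p r n z.2 * fderiv ℝ ψ z v| ≤ A * ‖v‖ := by
    rw [abs_mul, abs_of_nonneg (show 0 ≤ ballCutoff p r n z.2 from Real.smoothTransition.nonneg _)]
    calc _ ≤ 1 * |fderiv ℝ ψ z v| :=
          mul_le_mul_of_nonneg_right (Real.smoothTransition.le_one _) (abs_nonneg _)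
      _ ≤ A * ‖v‖ := by
        rw [one_mul]
        exact ((fderiv ℝ ψ z).le_opNorm v).trans (mul_le_mul_of_nonneg_right (hA z) (norm_nonneg _))
  have b2 : |ψ z * (deriv Real.smoothTransition (n * (r ^ 2 - ρ ^ 2) - 1)
        * (n * (-(2 * ⟪z.2 - p, v.2⟫))))| ≤ 4 * L * M * ‖v‖ := by
    by_cases hy : 1 < n * (r ^ 2 - ρ ^ 2) - 1
    · rw [Real.deriv_smoothTransition_of_one_lt hy, zero_mul, mul_zero, abs_zero]
      positivity
    · have hn : n * (r - ρ) * r ≤ 2 := by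
        have h1 : n * (r - ρ) * r ≤ n * (r - ρ) * (r + ρ) :=
          mul_le_mul_of_nonneg_left (by linarith)
            (mul_nonneg (Nat.cast_nonneg n) (by linarith))
        have h2 : (n : ℝ) * (r - ρ) * (r + ρ) = n * (r ^ 2 - ρ ^ 2) := by ring
        linarith
      have hc : |(n : ℝ) * (-(2 * ⟪z.2 - p, v.2⟫))| ≤ n * (2 * (r * ‖v‖)) := by
        rw [abs_mul, abs_neg, abs_mul, abs_two, Nat.abs_cast]
        gcongr
      rw [abs_mul, abs_mul]
      calc _ ≤ L * (r - ρ) * (M * (n * (2 * (r * ‖v‖)))) := by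
            gcongr
            exact hM _
        _ = 2 * L * M * ‖v‖ * (n * (r - ρ) * r) := by ring
        _ ≤ 2 * L * M * ‖v‖ * 2 := by gcongr
        _ = 4 * L * M * ‖v‖ := by ring
  calc _ ≤ _ := abs_add_le _ _
    _ ≤ A * ‖v‖ + 4 * L * M * ‖v‖ := add_le_add b1 b2
    _ = _ := by ring

/-- Green's functional of a finite energy solution in the ball vanishes on the test functions that
vanish on the sphere. -/
theorem integral_eq_zero_of_eqOn_sphere (hr : 0 < r) {ut : ℝ × E3 → ℝ} {G : ℝ × E3 → E3}
    (hut : MemLp ut 2 (volume.restrict (cyl T (Metric.ball p r))))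
    (hG : MemLp G 2 (volume.restrict (cyl T (Metric.ball p r))))
    (hwave : ∀ φ, IsTest (cyl T (Metric.ball p r)) φ →
      ∫ z in cyl T (Metric.ball p r), (ut z * dt φ z - dx φ z (G z)) = 0)
    {ψ : ℝ × E3 → ℝ} (hψ : IsTest (Ioo 0 T ×ˢ univ) ψ)
    (h0 : ∀ z ∈ Ioo 0 T ×ˢ Metric.sphere p r, ψ z = 0) :
    ∫ z in cyl T (Metric.ball p r), (dx ψ z (G z) - ut z * dt ψ z) = 0 := by
  set B := Metric.ball p r with hB
  have hfin : IsFiniteMeasure (volume.restrict (cyl T B)) := by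
    refine ⟨?_⟩
    rw [Measure.restrict_apply_univ]
    exact ((Metric.isBounded_Ioo 0 T).prod Metric.isBounded_ball).measure_lt_top
  have hmeas : MeasurableSet (cyl T B) := measurableSet_cyl T measurableSet_ball
  obtain ⟨C, hC⟩ := exists_abs_fderiv_ballCutoff_mul_le hψ hr h0
  have hut1 : Integrable ut (volume.restrict (cyl T B)) := hut.integrable (by norm_num)
  have hG1 : Integrable G (volume.restrict (cyl T B)) := hG.integrable (by norm_num)
  have hasm : ∀ {φ : ℝ × E3 → ℝ}, ContDiff ℝ ∞ φ →
      AEStronglyMeasurable (fun z => ut z * dt φ z - dx φ z (G z)) (volume.restrict (cyl T B)) := by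
    intro φ hφ
    have hc : Continuous (fderiv ℝ φ) := hφ.continuous_fderiv (by simp)
    refine (hut.1.mul (hc.clm_apply continuous_const).aestronglyMeasurable).sub ?_
    exact isBoundedBilinearMap_apply.continuous.comp_aestronglyMeasurable
      (hc.aestronglyMeasurable.prodMk ((aestronglyMeasurable_const (b := (0 : ℝ))).prodMk hG.1))
  -- Dominated convergence: at each point of the open ball the derivative of the cut off function
  -- eventually equals that of `ψ`, and the uniform bound provides the majorant.
  have hlim : Tendsto (fun n : ℕ => ∫ z in cyl T B,
      (ut z * dt (fun z => ballCutoff p r n z.2 * ψ z) z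
        - dx (fun z => ballCutoff p r n z.2 * ψ z) z (G z))) atTop
      (𝓝 (∫ z in cyl T B, (ut z * dt ψ z - dx ψ z (G z)))) := by
    refine tendsto_integral_of_dominated_convergence
      (fun z => |C| * (‖ut z‖ + ‖G z‖)) (fun n => hasm (isTest_ballCutoff_mul hψ hr.le n).1)
      ((hut1.norm.add hG1.norm).const_mul _) (fun n => ?_) ?_
    · filter_upwards [ae_restrict_mem hmeas] with z hz
      have h1 := (hC n z hz ((1 : ℝ), (0 : E3))).trans
        (mul_le_mul_of_nonneg_right (le_abs_self C) (norm_nonneg _))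
      have h2 := (hC n z hz ((0 : ℝ), G z)).trans
        (mul_le_mul_of_nonneg_right (le_abs_self C) (norm_nonneg _))
      simp only [Prod.norm_mk, norm_one, norm_zero, zero_le_one, sup_of_le_left, mul_one,
        norm_nonneg, sup_of_le_right] at h1 h2
      refine (norm_sub_le _ _).trans ?_
      rw [norm_mul, mul_add, mul_comm (‖ut z‖)]
      exact add_le_add (mul_le_mul_of_nonneg_right h1 (norm_nonneg _)) h2
    · filter_upwards [ae_restrict_mem hmeas] with z hz
      refine tendsto_const_nhds.congr' ?_
      filter_upwards [eventually_ballCutoff_argument hz.2] with n hn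
      have hv : ∀ v, fderiv ℝ (fun z => ballCutoff p r n z.2 * ψ z) z v = fderiv ℝ ψ z v := by
        intro v
        rw [fderiv_ballCutoff_mul hψ.differentiable, Real.deriv_smoothTransition_of_one_lt hn,
          ballCutoff, Real.smoothTransition.one_of_one_le hn.le]
        ring
      simp only [dt, dx, hv]
  simp only [hwave _ (isTest_ballCutoff_mul hψ hr.le _)] at hlim
  have h1 := tendsto_nhds_unique hlim tendsto_const_nhds
  rw [← neg_eq_zero, ← integral_neg, ← h1]
  congr 1 with z
  ring

end WaveProblem

/-! ### From the exterior problem to the ball: difference of two solutions -/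

namespace WaveProblem

variable {T : ℝ} {Ω B : Set E3}

lemma MemLinftyL2.memLp {F : Type*} [NormedAddCommGroup F] {v : ℝ × E3 → F}
    (hv : MemLinftyL2 T Ω v) : MemLp v 2 (volume.restrict (cyl T Ω)) := by
  obtain ⟨hm, C, hC⟩ := hv
  refine ⟨hm, ?_⟩
  rw [eLpNorm_lt_top_iff_lintegral_rpow_enorm_lt_top (by simp) (by simp)]
  have hμ : (volume : Measure (ℝ × E3)).restrict (cyl T Ω)
      = (volume.restrict (Ioo 0 T)).prod (volume.restrict Ω) := by
    rw [Measure.volume_eq_prod, cyl, Measure.prod_restrict]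
  rw [hμ] at hm ⊢
  rw [lintegral_prod _ (hm.enorm.pow_const _)]
  have hle : ∀ᵐ t ∂(volume.restrict (Ioo 0 T)),
      ∫⁻ x in Ω, ‖v (t, x)‖ₑ ^ (2 : ENNReal).toReal ≤ (C : ENNReal) ^ (2 : ℝ) := by
    filter_upwards [hC] with t ht
    rw [eLpNorm_eq_lintegral_rpow_enorm_toReal (by simp) (by simp)] at ht
    have := ENNReal.rpow_le_rpow ht (show (0 : ℝ) ≤ 2 by norm_num)
    rw [← ENNReal.rpow_mul] at this
    simpa using this
  refine (lintegral_mono_ae hle).trans_lt ?_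
  rw [lintegral_const]
  exact ENNReal.mul_lt_top (by simp) (by simp)

lemma cyl_mono (T : ℝ) (h : B ⊆ Ω) : cyl T B ⊆ cyl T Ω := prod_mono_right h

lemma IsTest.setIntegral_cyl {φ : ℝ × E3 → ℝ} (hφ : IsTest (Iio T ×ˢ B) φ) (hΩ : MeasurableSet Ω)
    (hB : B ⊆ Ω) {F : ℝ × E3 → ℝ} (hF : ∀ z, φ z = 0 → fderiv ℝ φ z = 0 → F z = 0) :
    ∫ z in cyl T Ω, F z = ∫ z in cyl T B, F z := by
  refine setIntegral_eq_of_subset_of_forall_sdiff_eq_zero (measurableSet_cyl T hΩ)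
    (cyl_mono T hB) fun z hz => ?_
  have : z ∉ Iio T ×ˢ B := fun h => hz.2 ⟨hz.1.1, h.2⟩
  exact hF z (hφ.eq_zero this) (hφ.fderiv_eq_zero this)

/-- A finite energy solution of the wave equation in `(0,T) × B`, with time derivative `ut` and
gradient `G`, and with zero initial values. -/
structure IsInteriorSolution (T : ℝ) (B : Set E3) (u ut : ℝ × E3 → ℝ) (G : ℝ × E3 → E3) :
    Prop where
  memLp : MemLp u 2 (volume.restrict (cyl T B))
  memLp_dt : MemLp ut 2 (volume.restrict (cyl T B))
  memLp_grad : MemLp G 2 (volume.restrict (cyl T B))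
  grad : IsWeakGradient T B u G
  deriv : ∀ φ, IsTest (Iio T ×ˢ B) φ →
    ∫ z in cyl T B, u z * dt φ z = -∫ z in cyl T B, ut z * φ z
  wave : ∀ φ, IsTest (Iio T ×ˢ B) φ → ∫ z in cyl T B, (ut z * dt φ z - dx φ z (G z)) = 0

lemma cyl_subset_Iio (T : ℝ) (B : Set E3) : cyl T B ⊆ Iio T ×ˢ B :=
  prod_mono_left Ioo_subset_Iio_self

/-- Only the equation, the initial values and the energy bounds survive the restriction to `B`. The
data on `∂D` play no part, which is why they may differ for the two solutions. -/
lemma IsWaveSolution.exists_isInteriorSolution {D : Set E3} {f g u : ℝ × E3 → ℝ}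
    (h : IsWaveSolution T D f g u) (hB : B ⊆ (closure D)ᶜ) :
    ∃ ut G, IsInteriorSolution T B u ut G := by
  obtain ⟨ut, G, hu, hut, hG, hgrad, hdt, hwave, -⟩ := h
  have hm : MeasurableSet (closure D)ᶜ := isClosed_closure.measurableSet.compl
  have hle : volume.restrict (cyl T B) ≤ volume.restrict (cyl T (closure D)ᶜ) :=
    Measure.restrict_mono (cyl_mono T hB) le_rfl
  refine ⟨ut, G, hu.memLp.mono_measure hle, hut.memLp.mono_measure hle,
    hG.memLp.mono_measure hle, fun φ hφ e => ?_, fun φ hφ => ?_, fun φ hφ => ?_⟩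
  · have hφ' := hφ.mono (cyl_subset_Iio T B)
    have := hgrad φ (hφ.mono (cyl_mono T hB)) e
    rwa [hφ'.setIntegral_cyl hm hB fun z _ h2 => by simp [dx, h2],
      hφ'.setIntegral_cyl hm hB fun z h1 _ => by simp [h1]] at this
  · have := hdt φ (hφ.mono (prod_mono_right hB))
    rwa [hφ.setIntegral_cyl hm hB fun z _ h2 => by simp [dt, h2],
      hφ.setIntegral_cyl hm hB fun z h1 _ => by simp [h1]] at this
  · have := hwave φ (hφ.mono (prod_mono_right hB))
    rwa [hφ.setIntegral_cyl hm hB fun z _ h2 => by simp [dt, dx, h2]] at this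

/-- A square integrable function on the cylinder, extended by zero, has a strongly measurable
representative. -/
lemma exists_isL2Cyl (hB : MeasurableSet B) {v : ℝ × E3 → ℝ}
    (hv : MemLp v 2 (volume.restrict (cyl T B))) :
    ∃ v', IsL2Cyl T B v' ∧ (∀ᵐ z ∂(volume.restrict (cyl T B)), v' z = v z) ∧
      ∀ F : ℝ × E3 → ℝ, ∫ z, v' z * F z = ∫ z in cyl T B, v z * F z := by
  have hm := measurableSet_cyl T hB
  have hae : ∀ᵐ z ∂(volume.restrict (cyl T B)), (cyl T B).indicator (hv.1.mk v) z = v z := by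
    filter_upwards [hv.1.ae_eq_mk, ae_restrict_mem hm] with z h1 h2
    rw [indicator_of_mem h2, ← h1]
  refine ⟨(cyl T B).indicator (hv.1.mk v), ⟨hv.1.stronglyMeasurable_mk.indicator hm, ?_,
    fun z hz => indicator_of_notMem hz _⟩, hae, fun F => ?_⟩
  · rw [memLp_indicator_iff_restrict hm]
    exact hv.ae_eq hv.1.ae_eq_mk
  · rw [← setIntegral_eq_integral_of_forall_compl_eq_zero (s := cyl T B)
      fun z hz => by rw [indicator_of_notMem hz, zero_mul]]
    refine integral_congr_ae ?_
    filter_upwards [hae] with z hz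
    rw [hz]

lemma exists_isL2Cyl_sub (hB : MeasurableSet B) {v₁ v₂ : ℝ × E3 → ℝ}
    (h₁ : MemLp v₁ 2 (volume.restrict (cyl T B))) (h₂ : MemLp v₂ 2 (volume.restrict (cyl T B))) :
    ∃ v, IsL2Cyl T B v ∧ (∀ᵐ z ∂(volume.restrict (cyl T B)), v z = v₁ z - v₂ z) ∧
      ∀ F : ℝ × E3 → ℝ, MemLp F 2 (volume.restrict (cyl T B)) →
        ∫ z, v z * F z = (∫ z in cyl T B, v₁ z * F z) - ∫ z in cyl T B, v₂ z * F z := by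
  obtain ⟨v, hv, hae, hF⟩ := exists_isL2Cyl hB (h₁.sub h₂)
  refine ⟨v, hv, hae, fun F hFm => ?_⟩
  rw [hF]
  refine Eq.trans ?_ (integral_sub (h₁.integrable_mul hFm) (h₂.integrable_mul hFm))
  congr 1 with z
  exact sub_mul _ _ _

section

variable {U s : Set (ℝ × E3)} {φ : ℝ × E3 → ℝ}

lemma IsTest.memLp (hφ : IsTest U φ) : MemLp φ 2 (volume.restrict s) :=
  (hφ.1.continuous.memLp_of_hasCompactSupport hφ.2.1).restrict _

lemma IsTest.memLp_fderiv_apply (hφ : IsTest U φ) (v : ℝ × E3) :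
    MemLp (fun z => fderiv ℝ φ z v) 2 (volume.restrict s) :=
  ((hφ.continuous_fderiv_apply v).memLp_of_hasCompactSupport
    (hφ.hasCompactSupport_fderiv_apply v)).restrict _

lemma IsTest.memLp_dt (hφ : IsTest U φ) : MemLp (fun z => dt φ z) 2 (volume.restrict s) :=
  hφ.memLp_fderiv_apply _

lemma IsTest.memLp_dx (hφ : IsTest U φ) (e : E3) :
    MemLp (fun z => dx φ z e) 2 (volume.restrict s) :=
  hφ.memLp_fderiv_apply _

end

lemma dx_eq_sum (φ : ℝ × E3 → ℝ) (z : ℝ × E3) (y : E3) :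
    dx φ z y = ∑ i, ⟪y, EuclideanSpace.basisFun (Fin 3) ℝ i⟫
      * dx φ z (EuclideanSpace.basisFun (Fin 3) ℝ i) := by
  have h : ∀ x, dx φ z x
      = ((fderiv ℝ φ z).comp (ContinuousLinearMap.inr ℝ ℝ E3)) x := fun x => by simp [dx]
  simp only [h]
  conv_lhs => rw [← (EuclideanSpace.basisFun (Fin 3) ℝ).sum_repr' y]
  rw [map_sum]
  refine Finset.sum_congr rfl fun i _ => ?_
  rw [map_smul, smul_eq_mul, real_inner_comm]

lemma _root_.MeasureTheory.MemLp.inner_const_right {α : Type*} [MeasurableSpace α] {μ : Measure α}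
    {G : α → E3} (hG : MemLp G 2 μ) (e : E3) : MemLp (fun z => ⟪G z, e⟫) 2 μ := by
  have := (innerSL ℝ e).comp_memLp' hG
  refine this.ae_eq (Eventually.of_forall fun z => ?_)
  simp [real_inner_comm]

/-- Two finite energy solutions with zero initial values and the same lateral Dirichlet trace
coincide. -/
theorem IsInteriorSolution.ae_eq (hT : 0 < T) (hBo : IsOpen B) (hBc : Convex ℝ B)
    (hBb : Bornology.IsBounded B) (hBn : B.Nonempty) {u₁ ut₁ u₂ ut₂ : ℝ × E3 → ℝ}
    {G₁ G₂ : ℝ × E3 → E3} (h₁ : IsInteriorSolution T B u₁ ut₁ G₁)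
    (h₂ : IsInteriorSolution T B u₂ ut₂ G₂) {S : Set E3} {n : E3 → E3} {h : ℝ × E3 → ℝ}
    (ht₁ : HasTrace T B S n u₁ h) (ht₂ : HasTrace T B S n u₂ h) :
    ∀ᵐ z ∂(volume.restrict (cyl T B)), u₁ z = u₂ z := by
  have hBm := hBo.measurableSet
  set b := EuclideanSpace.basisFun (Fin 3) ℝ with hb
  obtain ⟨-, -, H₁, hH₁, htr₁⟩ := ht₁
  obtain ⟨-, -, H₂, hH₂, htr₂⟩ := ht₂
  obtain ⟨w, hw, hwu, hwF⟩ := exists_isL2Cyl_sub hBm h₁.memLp h₂.memLp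
  obtain ⟨g, hg, -, hgF⟩ := exists_isL2Cyl_sub hBm h₁.memLp_dt h₂.memLp_dt
  choose G hG _ hGF using fun i => exists_isL2Cyl_sub hBm
    (h₁.memLp_grad.inner_const_right (b i)) (h₂.memLp_grad.inner_const_right (b i))
  choose H hH _ hHF using fun i => exists_isL2Cyl_sub hBm
    (hH₁.inner_const_right (b i)) (hH₂.inner_const_right (b i))
  have htrace : ∀ φ, IsTest (Ioo 0 T ×ˢ univ) φ → ∀ i,
      ∫ z, w z * dx φ z (b i) = -∫ z, H i z * φ z := by
    intro φ hφ i
    have s₁ := integral_add (h₁.memLp.integrable_mul (hφ.memLp_dx (b i)))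
      ((hH₁.inner_const_right (b i)).integrable_mul hφ.memLp)
    have s₂ := integral_add (h₂.memLp.integrable_mul (hφ.memLp_dx (b i)))
      ((hH₂.inner_const_right (b i)).integrable_mul hφ.memLp)
    -- Both Gauss formulas have the same boundary integral, so it cancels: `w` has zero trace.
    have e := (s₁.symm.trans (htr₁ φ hφ (b i))).trans (s₂.symm.trans (htr₂ φ hφ (b i))).symm
    simp only [Pi.mul_apply] at e
    rw [hwF _ (hφ.memLp_dx (b i)), hHF i _ hφ.memLp]
    linarith
  have hgrad : ∀ φ, IsTest (cyl T B) φ → ∀ i,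
      ∫ z, w z * dx φ z (b i) = -∫ z, G i z * φ z := by
    intro φ hφ i
    rw [hwF _ (hφ.memLp_dx (b i)), hGF i _ hφ.memLp, h₁.grad φ hφ (b i), h₂.grad φ hφ (b i)]
    ring
  -- The gradient in the definition of the trace is only asserted to exist. Test functions supported
  -- in the cylinder identify it with the gradient of the wave equation.
  have hGH : ∀ i, G i =ᵐ[volume] H i := fun i =>
    (hG i).ae_eq_of_forall_test hBo (hH i) fun φ hφ => by
      have e₁ := hgrad φ hφ i
      have e₂ := htrace φ (hφ.mono (prod_mono_right (subset_univ B))) i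
      linarith
  have hzero : w =ᵐ[volume] 0 := by
    refine ae_eq_zero_of_weak_wave hT hBo hBc hBb hBn b hw hg hG ?_ ?_ ?_
    · intro φ hφ
      rw [hwF _ hφ.memLp_dt, hgF _ hφ.memLp, h₁.deriv φ hφ, h₂.deriv φ hφ]
      ring
    · intro φ hφ
      have key : ∀ {u ut : ℝ × E3 → ℝ} {A : ℝ × E3 → E3}, IsInteriorSolution T B u ut A →
          ∫ z in cyl T B, ut z * dt φ z = ∑ i, ∫ z in cyl T B, ⟪A z, b i⟫ * dx φ z (b i) := by
        intro u ut A hs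
        have i₁ := hs.memLp_dt.integrable_mul hφ.memLp_dt
        have i₂ := fun i => (hs.memLp_grad.inner_const_right (b i)).integrable_mul
          (hφ.memLp_dx (b i))
        have e := hs.wave φ hφ
        simp only [dx_eq_sum φ _ (A _)] at e
        have e' := integral_sub i₁ (integrable_finsetSum Finset.univ fun i _ => i₂ i)
        rw [integral_finsetSum _ fun i _ => i₂ i] at e'
        exact sub_eq_zero.1 (e'.symm.trans e)
      rw [hgF _ hφ.memLp_dt, key h₁, key h₂, ← Finset.sum_sub_distrib]
      exact Finset.sum_congr rfl fun i _ => (hGF i _ (hφ.memLp_dx (b i))).symm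
    · intro φ hφ i
      rw [htrace φ hφ i, neg_inj]
      refine integral_congr_ae ?_
      filter_upwards [hGH i] with z hz
      rw [hz]
  filter_upwards [hwu, ae_restrict_of_ae hzero] with z h1 h2
  rw [h2] at h1
  exact sub_eq_zero.1 h1.symm

/-- Green's formula defines the normal derivative on the sphere of every function that coincides in
the ball with a finite energy solution. -/
lemma IsInteriorSolution.isSphereNormalDeriv {p : E3} {r : ℝ} (hr : 0 < r)
    {u ut : ℝ × E3 → ℝ} {G : ℝ × E3 → E3} (hs : IsInteriorSolution T (Metric.ball p r) u ut G)
    {v : ℝ × E3 → ℝ} (hv : ∀ᵐ z ∂(volume.restrict (cyl T (Metric.ball p r))), u z = v z) :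
    IsSphereNormalDeriv T p r v
      fun φ => ∫ z in cyl T (Metric.ball p r), (dx φ z (G z) - ut z * dt φ z) := by
  have hcongr : ∀ F : ℝ × E3 → ℝ, ∫ z in cyl T (Metric.ball p r), v z * F z
      = ∫ z in cyl T (Metric.ball p r), u z * F z := by
    intro F
    refine integral_congr_ae ?_
    filter_upwards [hv] with z hz
    rw [hz]
  refine ⟨fun φ φ' hφ hφ' heq => ?_, ut, G, hs.memLp_dt, hs.memLp_grad, fun φ hφ => ?_,
    fun φ hφ e => ?_, fun φ _ => rfl⟩
  · have hsubt : IsTest (Ioo 0 T ×ˢ univ) (φ - φ') :=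
      ⟨hφ.1.sub hφ'.1, hφ.2.1.sub hφ'.2.1,
        (tsupport_sub φ φ').trans (union_subset hφ.2.2 hφ'.2.2)⟩
    have h := integral_eq_zero_of_eqOn_sphere hr hs.memLp_dt hs.memLp_grad
      (fun ζ hζ => hs.wave ζ (hζ.mono (cyl_subset_Iio T _))) hsubt
      fun z hz => sub_eq_zero.2 (heq hz)
    have hfd : ∀ z, fderiv ℝ (φ - φ') z = fderiv ℝ φ z - fderiv ℝ φ' z := fun z =>
      fderiv_sub (hφ.differentiable z) (hφ'.differentiable z)
    have hint : ∀ {ζ : ℝ × E3 → ℝ}, IsTest (Ioo 0 T ×ˢ univ) ζ → Integrable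
        (fun z => dx ζ z (G z) - ut z * dt ζ z) (volume.restrict (cyl T (Metric.ball p r))) := by
      intro ζ hζ
      simp only [dx_eq_sum ζ _ (G _)]
      refine (integrable_finsetSum _ fun i _ => ?_).sub (hs.memLp_dt.integrable_mul hζ.memLp_dt)
      exact (hs.memLp_grad.inner_const_right _).integrable_mul (hζ.memLp_dx _)
    rw [← sub_eq_zero, ← integral_sub (hint hφ) (hint hφ'), ← h]
    congr 1 with z
    simp only [dx, dt, hfd, sub_apply]
    ring
  · rw [hcongr]
    exact hs.deriv φ (hφ.mono (cyl_subset_Iio T _))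
  · rw [hcongr]
    exact hs.grad φ hφ e

end WaveProblem

/-! ### Conclusion -/

theorem proposition1 (T₀ : ℝ) (hT : 0 < T₀)
    (D : Set E3) (hDo : IsOpen D) (hDb : Bornology.IsBounded D) (hDc : IsConnected D)
    (hDs : HasSmoothBoundary D)
    (p : E3) (r : ℝ) (hr : 0 < r) (hB : Metric.ball p r ⊆ (closure D)ᶜ)
    (f₁ g₁ u₁ f₂ g₂ u₂ : ℝ × E3 → ℝ)
    (h₁ : IsWaveSolution T₀ D f₁ g₁ u₁) (h₂ : IsWaveSolution T₀ D f₂ g₂ u₂)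
    (h : ℝ × E3 → ℝ)
    (ht₁ : HasSphereTrace T₀ p r u₁ h) (ht₂ : HasSphereTrace T₀ p r u₂ h) :
    (∀ᵐ z ∂(volume.restrict (Ioo 0 T₀ ×ˢ Metric.closedBall p r)), u₁ z = u₂ z) ∧
    ∃ N : (ℝ × E3 → ℝ) → ℝ,
      IsSphereNormalDeriv T₀ p r u₁ N ∧ IsSphereNormalDeriv T₀ p r u₂ N := by
  obtain ⟨ut₁, G₁, hs₁⟩ := h₁.exists_isInteriorSolution hB
  obtain ⟨ut₂, G₂, hs₂⟩ := h₂.exists_isInteriorSolution hB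
  have hae := hs₁.ae_eq hT Metric.isOpen_ball (convex_ball p r) Metric.isBounded_ball
    (Metric.nonempty_ball.2 hr) hs₂ ht₁ ht₂
  -- The functional built from the derivatives of `u₁` serves both solutions: as `u₁ = u₂` in the
  -- ball, these are also weak derivatives of `u₂`.
  refine ⟨?_, _, hs₁.isSphereNormalDeriv hr (ae_of_all _ fun _ => rfl),
    hs₁.isSphereNormalDeriv hr hae⟩
  -- The sphere is a null set, so the closed ball may replace the open one.
  have hball : (Metric.ball p r : Set E3) =ᵐ[volume] Metric.closedBall p r := by
    refine Metric.ball_subset_closedBall.eventuallyLE.antisymm ?_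
    rw [ae_le_set, Metric.closedBall_sdiff_ball]
    exact Measure.addHaar_sphere volume p r
  have hset : (cyl T₀ (Metric.ball p r) : Set (ℝ × E3))
      =ᵐ[volume] Ioo 0 T₀ ×ˢ Metric.closedBall p r := by
    rw [Measure.volume_eq_prod]
    exact Measure.set_prod_ae_eq .rfl hball
  rw [← Measure.restrict_congr_set hset]
  exact hae
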